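/- For $c\in\mathbb{R}$ let $\mathbb{H}_c=L^2(\mathbb{R},e^{-2ct}\,dt)$ (complex-valued functions), and let $\partial_c$ be the unbounded operator $\partial_c f=f'$ on $\mathbb{H}_c$ with domain $D(\partial_c)=\{f\in\mathbb{H}_c\cap AC(\mathbb{R}) : f'\in\mathbb{H}_c\}$, where $AC(\mathbb{R})$ is the space of locally absolutely continuous functions. The operator $V_c=\frac{1}{i}(\partial_c-c)$ is self-adjoint, and $\partial_c=c+iV_c$ is normal. The spectral operator is $\mathfrak{a}_c=\zeta(\partial_c)$, where $\zeta$ is the Riemann zeta function; here and below functions of (possibly unbounded) normal operators are given by the measurable functional calculus. For $T>0$, a $T$-admissible cut-off function is a continuous function $\phi^{(T)}:\mathbb{R}\to\mathbb{R}$ the closure of whose range is $[-T,T]$; the truncated infinitesimal shift and the truncated spectral operator are $$\partial_c^{(T)}=c+i\,\phi^{(T)}(V_c),\qquad \mathfrak{a}_c^{(T)}=\zeta\bigl(\partial_c^{(T)}\bigr).$$ An operator $A$ on $\mathbb{H}_c$ with domain $D(A)$ is invertible if there is a bounded operator $B$ on $\mathbb{H}_c$ with range $D(A)$ such that $ABu=u$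 for all $u\in\mathbb{H}_c$ and $BAv=v$ for all $v\in D(A)$. The spectral operator $\mathfrak{a}_c$ is quasi-invertible if $\mathfrak{a}_c^{(T)}$ is invertible for every $T>0$. **Theorem.** For each $c\in(0,1)$ and $T>0$ let $\phi_c^{(T)}$ be an arbitrary $T$-admissible cut-off function, used to form $\mathfrak{a}_c^{(T)}$. Then the following are equivalent: 1. $\mathfrak{a}_c$ is quasi-invertible for every $c\in(0,1)\setminus\{\tfrac12\}$; 2. $\mathfrak{a}_c$ is quasi-invertible for every $c\in(\tfrac12,1)$; 3. the Riemann hypothesis is true. -/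

import Mathlib

open MeasureTheory Set
open scoped InnerProductSpace ENNReal

noncomputable section

namespace SpectralOperator

/-! ### Measurable functional calculus for unbounded normal operators -/

section FunctionalCalculus

variable {H : Type*} [NormedAddCommGroup H] [InnerProductSpace ℂ H] [CompleteSpace H]

/-- A resolution of the identity (projection-valued measure) on the Borel sets of `ℂ`.  The values
on sets that are not measurable play no role. -/
structure ResolutionOfIdentity (H : Type*) [NormedAddCommGroup H] [InnerProductSpace ℂ H]
    [CompleteSpace H] where
  proj : Set ℂ → H →L[ℂ] H
  isStarProjection : ∀ s, MeasurableSet s → IsStarProjection (proj s)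
  empty : proj ∅ = 0
  univ : proj Set.univ = 1
  inter : ∀ s t, MeasurableSet s → MeasurableSet t → proj (s ∩ t) = proj s * proj t
  iUnion : ∀ s : ℕ → Set ℂ, (∀ n, MeasurableSet (s n)) → Pairwise (Function.onFun Disjoint s) →
    ∀ x, HasSum (fun n => proj (s n) x) (proj (⋃ n, s n) x)

namespace ResolutionOfIdentity

theorem inner_proj_self (E : ResolutionOfIdentity H) {s : Set ℂ} (hs : MeasurableSet s) (x : H) :
    ⟪x, E.proj s x⟫_ℂ = ((‖E.proj s x‖ ^ 2 : ℝ) : ℂ) := by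
  have h := E.isStarProjection s hs
  have h1 : E.proj s (E.proj s x) = E.proj s x := by
    have := h.isIdempotentElem
    exact congrArg (fun A : H →L[ℂ] H => A x) this
  have h2 : ContinuousLinearMap.adjoint (E.proj s) = E.proj s := h.isSelfAdjoint
  calc ⟪x, E.proj s x⟫_ℂ = ⟪x, E.proj s (E.proj s x)⟫_ℂ := by rw [h1]
    _ = ⟪E.proj s x, E.proj s x⟫_ℂ := by
        conv_lhs => rw [← h2]
        rw [ContinuousLinearMap.adjoint_inner_right, h2]
    _ = _ := by rw [inner_self_eq_norm_sq_to_K]; push_cast; rfl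

theorem enorm_sq_iUnion (E : ResolutionOfIdentity H) (x : H) (s : ℕ → Set ℂ)
    (hs : ∀ n, MeasurableSet (s n)) (hd : Pairwise (Function.onFun Disjoint s)) :
    ENNReal.ofReal (‖E.proj (⋃ n, s n) x‖ ^ 2) = ∑' n, ENNReal.ofReal (‖E.proj (s n) x‖ ^ 2) := by
  have h1 := (E.iUnion s hs hd x).mapL (innerSL ℂ x)
  simp only [innerSL_apply_apply, E.inner_proj_self (hs _), E.inner_proj_self (.iUnion hs)] at h1
  have h2 : HasSum (fun n => ‖E.proj (s n) x‖ ^ 2) (‖E.proj (⋃ n, s n) x‖ ^ 2) := by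
    exact_mod_cast h1
  rw [← h2.tsum_eq, ENNReal.ofReal_tsum_of_nonneg (fun _ => by positivity) h2.summable]

/-- The scalar measure `E_x(s) = ⟨E(s) x, x⟩ = ‖E(s) x‖²`. -/
def scalarMeasure (E : ResolutionOfIdentity H) (x : H) : Measure ℂ :=
  Measure.ofMeasurable (fun s _ => ENNReal.ofReal (‖E.proj s x‖ ^ 2))
    (by simp [E.empty]) (fun s hs hd => E.enorm_sq_iUnion x s hs hd)

/-- `A = ∫ f dE`: the domain of `A` is `{x | ∫ |f|² dE_x < ∞}`, and `⟨A x, x⟩ = ∫ f dE_x` for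
every `x` in this domain.  (Mathlib's inner product is linear in the second variable.)  Since the
domain is a dense subspace, by polarization there is only one such `A`. -/
def IsIntegral (E : ResolutionOfIdentity H) (f : ℂ → ℂ) (A : H →ₗ.[ℂ] H) : Prop :=
  (∀ x : H, x ∈ A.domain ↔ ∫⁻ z, ‖f z‖ₑ ^ 2 ∂(E.scalarMeasure x) < ∞) ∧
    ∀ x : A.domain, ⟪(x : H), A x⟫_ℂ = ∫ z, f z ∂(E.scalarMeasure (x : H))

end ResolutionOfIdentity

/-- `A = f(N)`: there is a resolution of the identity `E` with `N = ∫ z dE(z)` (the spectral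
measure of `N`) and `A = ∫ f(z) dE(z)`. -/
def IsFunctionOf (f : ℂ → ℂ) (N A : H →ₗ.[ℂ] H) : Prop :=
  ∃ E : ResolutionOfIdentity H, E.IsIntegral (fun z => z) N ∧ E.IsIntegral f A

open Classical in
/-- The operator `f(N)` given by the measurable functional calculus, for `N` a possibly unbounded
normal operator and `f` a Borel function.  By the spectral theorem `f(N)` exists and is unique; the
junk value, for other `N`, is the zero operator on the zero subspace. -/
def functionalCalculus (f : ℂ → ℂ) (N : H →ₗ.[ℂ] H) : H →ₗ.[ℂ] H :=
  if h : ∃ A, IsFunctionOf f N A then h.choose else ⊥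

/-- Multiplication by the constant `a`, as an everywhere defined operator. -/
def constOp (H : Type*) [NormedAddCommGroup H] [InnerProductSpace ℂ H] (a : ℂ) : H →ₗ.[ℂ] H :=
  (a • (LinearMap.id : H →ₗ[ℂ] H)).toPMap ⊤

/-- A possibly unbounded operator `A` is invertible if it has an inverse that is bounded and defined
on the whole space. -/
def IsInvertible (A : H →ₗ.[ℂ] H) : Prop :=
  ∃ B : H →L[ℂ] H, Set.range B = (A.domain : Set H) ∧
    (∀ (u : H) (hu : B u ∈ A.domain), A ⟨B u, hu⟩ = u) ∧ ∀ v : A.domain, B (A v) = v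

end FunctionalCalculus

/-! ### The weighted space and the infinitesimal shift -/

/-- The measure `μ_c(dt) = e^{-2ct} dt` on the real line. -/
def weightMeasure (c : ℝ) : Measure ℝ :=
  (volume : Measure ℝ).withDensity (fun t => ENNReal.ofReal (Real.exp (-2 * c * t)))

/-- The Hilbert space `ℍ_c = L²(ℝ, μ_c)` of complex-valued functions. -/
abbrev HilbertSpace (c : ℝ) : Type := Lp ℂ 2 (weightMeasure c)

/-- The graph of the infinitesimal shift: pairs `(f, g)` of elements of `ℍ_c` such that `f` is
(a.e. equal to) a locally absolutely continuous function whose a.e. derivative is `g`. -/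
def shiftGraph (c : ℝ) : Submodule ℂ (HilbertSpace c × HilbertSpace c) where
  carrier := {p | ∃ F : ℝ → ℂ, (∀ a b : ℝ, AbsolutelyContinuousOnInterval F a b) ∧
    (∀ᵐ t ∂(weightMeasure c), p.1 t = F t) ∧ ∀ᵐ t ∂(weightMeasure c), HasDerivAt F (p.2 t) t}
  zero_mem' := by
    refine ⟨fun _ => 0, fun a b => ?_, Lp.coeFn_zero ℂ 2 _, ?_⟩
    · exact (LipschitzWith.const (0 : ℂ)).lipschitzOnWith.absolutelyContinuousOnInterval
    · filter_upwards [Lp.coeFn_zero ℂ 2 (weightMeasure c)] with t ht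
      have : (0 : HilbertSpace c × HilbertSpace c).2 t = 0 := ht
      rw [this]
      exact hasDerivAt_const t 0
  add_mem' := by
    rintro p q ⟨F, hF, hpF, hF'⟩ ⟨G, hG, hqG, hG'⟩
    refine ⟨F + G, fun a b => (hF a b).add (hG a b), ?_, ?_⟩
    · filter_upwards [hpF, hqG, Lp.coeFn_add p.1 q.1] with t h1 h2 h3
      rw [Prod.fst_add, h3, Pi.add_apply, h1, h2, Pi.add_apply]
    · filter_upwards [hF', hG', Lp.coeFn_add p.2 q.2] with t h1 h2 h3
      rw [Prod.snd_add, h3]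
      exact h1.add h2
  smul_mem' := by
    rintro a p ⟨F, hF, hpF, hF'⟩
    refine ⟨a • F, fun x y => (hF x y).const_smul a, ?_, ?_⟩
    · filter_upwards [hpF, Lp.coeFn_smul a p.1] with t h1 h3
      rw [Prod.smul_fst, h3, Pi.smul_apply, h1, Pi.smul_apply]
    · filter_upwards [hF', Lp.coeFn_smul a p.2] with t h1 h3
      rw [Prod.smul_snd, h3]
      exact h1.const_smul a

theorem volume_absolutelyContinuous_weightMeasure (c : ℝ) :
    (volume : Measure ℝ) ≪ weightMeasure c :=
  withDensity_absolutelyContinuous' (by fun_prop)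
    (Filter.Eventually.of_forall fun t => by simp [Real.exp_pos])

/-- The graph is single-valued, so that it is the graph of an operator. -/
theorem shiftGraph_single_valued (c : ℝ) (p : HilbertSpace c × HilbertSpace c)
    (hp : p ∈ shiftGraph c) (h0 : p.1 = 0) : p.2 = 0 := by
  obtain ⟨F, hF, hpF, hF'⟩ := hp
  have hcont : Continuous F := by
    rw [continuous_iff_continuousAt]
    intro t
    have := (hF (t - 1) (t + 1)).continuousOn
    rw [uIcc_of_le (by linarith)] at this
    exact this.continuousAt (Icc_mem_nhds (by linarith) (by linarith))
  have hz : ∀ᵐ t ∂(weightMeasure c), F t = 0 := by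
    filter_upwards [hpF, Lp.coeFn_zero ℂ 2 (weightMeasure c)] with t h1 h2
    rw [← h1, h0, h2, Pi.zero_apply]
  have hF0 : F = fun _ => 0 :=
    (hcont.ae_eq_iff_eq volume continuous_const).1
      ((volume_absolutelyContinuous_weightMeasure c).ae_le hz)
  rw [Lp.eq_zero_iff_ae_eq_zero]
  filter_upwards [hF'] with t ht
  rw [hF0] at ht
  exact ht.unique (hasDerivAt_const t 0)

/-- The infinitesimal shift `∂_c f = f'` on
`D(∂_c) = {f ∈ ℍ_c ∩ AC(ℝ) | f' ∈ ℍ_c}`. -/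
def infinitesimalShift (c : ℝ) : HilbertSpace c →ₗ.[ℂ] HilbertSpace c :=
  (shiftGraph c).toLinearPMap

theorem infinitesimalShift_graph (c : ℝ) : (infinitesimalShift c).graph = shiftGraph c :=
  Submodule.toLinearPMap_graph_eq _ (shiftGraph_single_valued c)

/-- The spectral operator `𝔞_c = ζ(∂_c)`, with domain `{f ∈ D(∂_c) | ζ(∂_c) f ∈ ℍ_c}`. -/
def spectralOperator (c : ℝ) : HilbertSpace c →ₗ.[ℂ] HilbertSpace c :=
  (functionalCalculus riemannZeta (infinitesimalShift c)).domRestrict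
    (infinitesimalShift c).domain

/-- The self-adjoint operator `V_c = (∂_c - c) / i`, so that `∂_c = c + i V_c`. -/
def momentum (c : ℝ) : HilbertSpace c →ₗ.[ℂ] HilbertSpace c :=
  (Complex.I)⁻¹ • (infinitesimalShift c - constOp (HilbertSpace c) c)

/-! ### Truncations and quasi-invertibility -/

/-- `T`-admissible cut-off functions (for `c ≠ 1`): continuous functions on `ℝ` the closure of whose
range is `[-T, T]`. -/
def IsAdmissibleCutoff (T : ℝ) (φ : ℝ → ℝ) : Prop :=
  Continuous φ ∧ closure (Set.range φ) = Set.Icc (-T) T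

/-- The truncated infinitesimal shift `∂_c^{(T)} = c + i φ(V_c)`, for the cut-off function `φ`.
The spectral measure of the self-adjoint operator `V_c` lives on the real line, so that `φ` may be
extended to `ℂ` as `z ↦ φ (re z)`. -/
def truncatedShift (c : ℝ) (φ : ℝ → ℝ) : HilbertSpace c →ₗ.[ℂ] HilbertSpace c :=
  constOp (HilbertSpace c) c +
    Complex.I • functionalCalculus (fun z => (φ z.re : ℂ)) (momentum c)

/-- The truncated spectral operator `𝔞_c^{(T)} = ζ(∂_c^{(T)})`. -/
def truncatedSpectralOperator (c : ℝ) (φ : ℝ → ℝ) : HilbertSpace c →ₗ.[ℂ] HilbertSpace c :=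
  functionalCalculus riemannZeta (truncatedShift c φ)

/-- Quasi-invertibility of the spectral operator `𝔞_c`: its truncation `𝔞_c^{(T)}`, formed with the
cut-off function `φ T`, is invertible for every `T > 0`. -/
def IsQuasiInvertible (c : ℝ) (φ : ℝ → ℝ → ℝ) : Prop :=
  ∀ T : ℝ, 0 < T → IsInvertible (truncatedSpectralOperator c (φ T))

end SpectralOperator

end

/-!
Conjugation by `f ↦ 𝓕(e^{-ct} f)` turns `∂_c` into multiplication by `c + 2πiξ`, so `V_c` has a
resolution of the identity whose support is the real line. The domains agree because
`(1 + d/dt)⁻¹`, whose symbol `(1 + 2πiξ)⁻¹` is bounded and preserves Schwartz functions, can be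
compared with its Fourier multiplier on a dense subspace and then by continuity.

Pushing the spectral measure forward along `v ↦ c + i φ(v)` shows that the spectrum of the truncated
shift is the compact segment `c + i[-T, T]`. There `ζ` is continuous, so by spectral mapping the
truncated spectral operator is invertible if and only if `ζ` has no zero on the segment. Hence
quasi-invertibility at `c` says that `ζ` has no zero on the line `Re s = c`, and the functional
equation reflects the zeros to the left of the critical line to its right.
-/

open Filter Topology

namespace SpectralOperator

theorem inner_map_eq_zero_of_inner_map_self_eq_zero {H : Type*} [NormedAddCommGroup H]
    [InnerProductSpace ℂ H] {D : Submodule ℂ H} {T : D →ₗ[ℂ] H}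
    (hT : ∀ x : D, ⟪(x : H), T x⟫_ℂ = 0) (y x : D) : ⟪(y : H), T x⟫_ℂ = 0 := by
  have h₁ := hT (x + y)
  have h₂ := hT (x + Complex.I • y)
  simp only [Submodule.coe_add, Submodule.coe_smul, map_add, map_smul, inner_add_left,
    inner_add_right, inner_smul_left, inner_smul_right, hT, Complex.conj_I] at h₁ h₂
  linear_combination (1 / 2) * h₁ + (Complex.I / 2) * h₂ +
    (1 / 2) * (⟪(y : H), T x⟫_ℂ - ⟪(x : H), T y⟫_ℂ) * Complex.I_sq

section SpectralTheory

variable {H : Type*} [NormedAddCommGroup H] [InnerProductSpace ℂ H] [CompleteSpace H]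

theorem sq_eLpNorm_two {α : Type*} [MeasurableSpace α] {F : Type*} [NormedAddCommGroup F]
    (f : α → F) (μ : Measure α) : eLpNorm f 2 μ ^ 2 = ∫⁻ z, ‖f z‖ₑ ^ 2 ∂μ := by
  simpa using eLpNorm_nnreal_pow_eq_lintegral (f := f) (μ := μ) (p := 2) two_ne_zero

theorem memLp_two_iff_lintegral {α : Type*} [MeasurableSpace α] {μ : Measure α} {f : α → ℂ}
    (hf : Measurable f) : MemLp f 2 μ ↔ ∫⁻ z, ‖f z‖ₑ ^ 2 ∂μ < ∞ := by
  rw [MemLp, ← sq_eLpNorm_two, ENNReal.pow_lt_top_iff]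
  simp [hf.aestronglyMeasurable]

namespace ResolutionOfIdentity

variable (E : ResolutionOfIdentity H) {s t : Set ℂ}

theorem scalarMeasure_apply (hs : MeasurableSet s) (x : H) :
    E.scalarMeasure x s = ‖E.proj s x‖ₑ ^ 2 := by
  rw [scalarMeasure, Measure.ofMeasurable_apply s hs, ENNReal.ofReal_pow (norm_nonneg _),
    ofReal_norm]

theorem scalarMeasure_univ (x : H) : E.scalarMeasure x Set.univ = ‖x‖ₑ ^ 2 := by
  rw [E.scalarMeasure_apply .univ, E.univ, one_apply_eq_self]

instance isFiniteMeasure_scalarMeasure (x : H) : IsFiniteMeasure (E.scalarMeasure x) :=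
  ⟨by rw [E.scalarMeasure_univ]; exact ENNReal.pow_lt_top enorm_lt_top⟩

theorem scalarMeasure_eq_zero_iff (hs : MeasurableSet s) (x : H) :
    E.scalarMeasure x s = 0 ↔ E.proj s x = 0 := by
  simp [E.scalarMeasure_apply hs]

theorem proj_eq_zero_iff (hs : MeasurableSet s) :
    E.proj s = 0 ↔ ∀ x, E.scalarMeasure x s = 0 := by
  simp only [ContinuousLinearMap.ext_iff, zero_apply, E.scalarMeasure_eq_zero_iff hs]

theorem proj_proj (hs : MeasurableSet s) (ht : MeasurableSet t) (x : H) :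
    E.proj s (E.proj t x) = E.proj (s ∩ t) x := by
  rw [E.inter s t hs ht, mul_apply_eq_comp]

theorem star_proj (hs : MeasurableSet s) : star (E.proj s) = E.proj s :=
  (E.isStarProjection s hs).isSelfAdjoint

open Classical in
/-- The vector measure `s ↦ E(s) x`; through it the finite additivity of `E` follows from the
countable additivity. -/
noncomputable def vectorMeasure (x : H) : VectorMeasure ℂ H where
  measureOf' s := if MeasurableSet s then E.proj s x else 0
  empty' := by simp [E.empty]
  not_measurable' _ hs := if_neg hs
  m_iUnion' s hs hd := by
    simpa only [hs, MeasurableSet.iUnion hs, if_true] using E.iUnion s hs hd x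

theorem vectorMeasure_apply (hs : MeasurableSet s) (x : H) : E.vectorMeasure x s = E.proj s x :=
  if_pos hs

theorem proj_union (hs : MeasurableSet s) (ht : MeasurableSet t) (hst : Disjoint s t) :
    E.proj (s ∪ t) = E.proj s + E.proj t := by
  ext x
  simpa only [E.vectorMeasure_apply, hs, ht, hs.union ht] using!
    (E.vectorMeasure x).of_union hst hs ht

theorem scalarMeasure_proj (hs : MeasurableSet s) (x : H) :
    E.scalarMeasure (E.proj s x) = (E.scalarMeasure x).restrict s := by
  ext t ht
  rw [Measure.restrict_apply ht, E.scalarMeasure_apply ht, E.scalarMeasure_apply (ht.inter hs),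
    E.proj_proj ht hs]

theorem scalarMeasure_zero : E.scalarMeasure 0 = 0 := by
  rw [← Measure.measure_univ_eq_zero, E.scalarMeasure_univ]
  simp

theorem scalarMeasure_smul (a : ℂ) (x : H) :
    E.scalarMeasure (a • x) = ‖a‖ₑ ^ 2 • E.scalarMeasure x := by
  ext t ht
  simp only [Measure.smul_apply, E.scalarMeasure_apply ht, map_smul, enorm_smul, mul_pow,
    smul_eq_mul]

theorem scalarMeasure_add_le (x y : H) :
    E.scalarMeasure (x + y) ≤ (2 : ℝ≥0∞) • (E.scalarMeasure x + E.scalarMeasure y) := by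
  refine Measure.le_iff.2 fun t ht => ?_
  simp only [Measure.smul_apply, Measure.add_apply, E.scalarMeasure_apply ht, map_add, smul_eq_mul]
  calc ‖E.proj t x + E.proj t y‖ₑ ^ 2 ≤ (‖E.proj t x‖ₑ + ‖E.proj t y‖ₑ) ^ 2 := by
        gcongr; exact enorm_add_le _ _
    _ ≤ 2 * (‖E.proj t x‖ₑ ^ 2 + ‖E.proj t y‖ₑ ^ 2) := by
        simpa [ENNReal.rpow_two, show (2 : ℝ) - 1 = 1 by norm_num] using
          ENNReal.rpow_add_le_mul_rpow_add_rpow ‖E.proj t x‖ₑ ‖E.proj t y‖ₑ (p := 2) (by norm_num)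

/-- The push-forward of a resolution of the identity under a measurable map. -/
noncomputable def map (h : ℂ → ℂ) (hh : Measurable h) : ResolutionOfIdentity H where
  proj s := E.proj (h ⁻¹' s)
  isStarProjection s hs := E.isStarProjection _ (hh hs)
  empty := by simp [E.empty]
  univ := by simp [E.univ]
  inter s t hs ht := by rw [preimage_inter, E.inter _ _ (hh hs) (hh ht)]
  iUnion s hs hd x := by
    rw [preimage_iUnion]
    exact E.iUnion _ (fun n => hh (hs n)) (fun m n hmn => (hd hmn).preimage h) x

theorem scalarMeasure_map {h : ℂ → ℂ} (hh : Measurable h) (x : H) :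
    (E.map h hh).scalarMeasure x = (E.scalarMeasure x).map h := by
  ext s hs
  rw [Measure.map_apply hh hs, scalarMeasure_apply _ hs, E.scalarMeasure_apply (hh hs), map]

theorem isIntegral_map_iff {f h : ℂ → ℂ} (hf : Measurable f) (hh : Measurable h)
    {A : H →ₗ.[ℂ] H} : (E.map h hh).IsIntegral f A ↔ E.IsIntegral (fun z => f (h z)) A := by
  simp only [IsIntegral, E.scalarMeasure_map hh, lintegral_map (hf.enorm.pow_const 2) hh,
    integral_map hh.aemeasurable hf.aestronglyMeasurable]

/-! ### The spectral integral -/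

/-- The operator `∫ g dE` for a simple function `g`. -/
noncomputable def simpleIntegral (g : SimpleFunc ℂ ℂ) : H →L[ℂ] H :=
  ∑ a ∈ g.range, a • E.proj (g ⁻¹' {a})

theorem simpleIntegral_eq_setToSimpleFunc (g : SimpleFunc ℂ ℂ) :
    E.simpleIntegral g =
      g.setToSimpleFunc fun s => (1 : ℂ →L[ℝ] ℂ).smulRight (E.proj s) := rfl

theorem finMeasAdditive_proj : FinMeasAdditive (0 : Measure ℂ)
    fun s => (1 : ℂ →L[ℝ] ℂ).smulRight (E.proj s) := by
  intro s t hs ht _ _ hst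
  ext a : 1
  simp [E.proj_union hs ht hst]

theorem simpleIntegral_sub (g h : SimpleFunc ℂ ℂ) :
    E.simpleIntegral (g - h) = E.simpleIntegral g - E.simpleIntegral h :=
  SimpleFunc.setToSimpleFunc_sub _ E.finMeasAdditive_proj integrable_zero_measure
    integrable_zero_measure

theorem simpleIntegral_map {β : Type*} [NormedAddCommGroup β] (g : SimpleFunc ℂ β) {k : β → ℂ}
    (hk : k 0 = 0) :
    E.simpleIntegral (g.map k) = ∑ b ∈ g.range, k b • E.proj (g ⁻¹' {b}) :=
  SimpleFunc.map_setToSimpleFunc _ E.finMeasAdditive_proj integrable_zero_measure hk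

theorem simpleIntegral_piecewise (hs : MeasurableSet s) (a : ℂ) :
    E.simpleIntegral (.piecewise s hs (.const ℂ a) (.const ℂ 0)) = a • E.proj s := by
  rw [simpleIntegral_eq_setToSimpleFunc, SimpleFunc.setToSimpleFunc_indicator _
    E.finMeasAdditive_proj.map_empty_eq_zero hs a]
  rfl

theorem star_simpleIntegral (g : SimpleFunc ℂ ℂ) :
    star (E.simpleIntegral g) = E.simpleIntegral (g.map star) := by
  rw [E.simpleIntegral_map g (star_zero ℂ), simpleIntegral, star_sum]
  exact Finset.sum_congr rfl fun a _ => by rw [star_smul, E.star_proj (g.measurableSet_fiber a)]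

theorem simpleIntegral_mul (g h : SimpleFunc ℂ ℂ) :
    E.simpleIntegral (g * h) = E.simpleIntegral g * E.simpleIntegral h := by
  calc E.simpleIntegral (g * h) = E.simpleIntegral ((g.pair h).map fun p => p.1 * p.2) := rfl
    _ = ∑ p ∈ (g.pair h).range, (p.1 * p.2) • E.proj (g.pair h ⁻¹' {p}) :=
        E.simpleIntegral_map _ (zero_mul _)
    _ = ∑ p ∈ g.range ×ˢ h.range, (p.1 * p.2) • E.proj (g.pair h ⁻¹' {p}) := by
        refine Finset.sum_subset (fun p hp => ?_) fun p _ hp => ?_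
        · obtain ⟨z, rfl⟩ := SimpleFunc.mem_range.1 hp
          exact Finset.mk_mem_product (g.mem_range_self z) (h.mem_range_self z)
        · rw [(SimpleFunc.preimage_eq_empty_iff _ p).2 hp, E.empty, smul_zero]
    _ = ∑ p ∈ g.range ×ˢ h.range, (p.1 • E.proj (g ⁻¹' {p.1})) * (p.2 • E.proj (h ⁻¹' {p.2})) := by
        refine Finset.sum_congr rfl fun p _ => ?_
        rw [smul_mul_smul_comm, ← E.inter _ _ (g.measurableSet_fiber _) (h.measurableSet_fiber _),
          ← SimpleFunc.pair_preimage_singleton]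
    _ = E.simpleIntegral g * E.simpleIntegral h := by
        rw [Finset.sum_product, simpleIntegral, simpleIntegral, Finset.sum_mul_sum]

theorem inner_simpleIntegral (g : SimpleFunc ℂ ℂ) (x : H) :
    ⟪x, E.simpleIntegral g x⟫_ℂ = ∫ z, g z ∂E.scalarMeasure x := by
  rw [g.integral_eq_sum (g.integrable_of_isFiniteMeasure), simpleIntegral,
    _root_.sum_apply, inner_sum]
  refine Finset.sum_congr rfl fun a _ => ?_
  rw [_root_.smul_apply, inner_smul_right, E.inner_proj_self (g.measurableSet_fiber a),
    Measure.real, E.scalarMeasure_apply (g.measurableSet_fiber a)]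
  simp [mul_comm]

theorem enorm_simpleIntegral (g : SimpleFunc ℂ ℂ) (x : H) :
    ‖E.simpleIntegral g x‖ₑ = eLpNorm g 2 (E.scalarMeasure x) := by
  have h : ((‖E.simpleIntegral g x‖ ^ 2 : ℝ) : ℂ) =
      ((∫ z, ‖g z‖ ^ 2 ∂E.scalarMeasure x : ℝ) : ℂ) := by
    calc ((‖E.simpleIntegral g x‖ ^ 2 : ℝ) : ℂ)
        = ⟪E.simpleIntegral g x, E.simpleIntegral g x⟫_ℂ := by
          simp [inner_self_eq_norm_sq_to_K]
      _ = ⟪x, E.simpleIntegral (g.map star * g) x⟫_ℂ := by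
          rw [E.simpleIntegral_mul, ← E.star_simpleIntegral, mul_apply_eq_comp,
            ContinuousLinearMap.star_eq_adjoint, ContinuousLinearMap.adjoint_inner_right]
      _ = ((∫ z, ‖g z‖ ^ 2 ∂E.scalarMeasure x : ℝ) : ℂ) := by
          rw [E.inner_simpleIntegral, ← integral_complex_ofReal]
          simp [← Complex.normSq_eq_norm_sq, Complex.normSq_eq_conj_mul_self]
  refine (ENNReal.pow_right_strictMono two_ne_zero).injective ?_
  simp only [sq_eLpNorm_two]
  calc ‖E.simpleIntegral g x‖ₑ ^ 2 = ENNReal.ofReal (‖E.simpleIntegral g x‖ ^ 2) := by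
        rw [ENNReal.ofReal_pow (norm_nonneg _), ofReal_norm]
    _ = ENNReal.ofReal (∫ z, ‖g z‖ ^ 2 ∂E.scalarMeasure x) := by rw [Complex.ofReal_injective h]
    _ = ∫⁻ z, ‖g z‖ₑ ^ 2 ∂E.scalarMeasure x := by
        rw [ofReal_integral_eq_lintegral_ofReal
          (g.memLp_of_isFiniteMeasure 2 _).integrable_norm_pow' (.of_forall fun z => by positivity)]
        simp only [ENNReal.ofReal_pow (norm_nonneg _), ofReal_norm]

theorem edist_simpleIntegral (g h : SimpleFunc ℂ ℂ) (x : H) :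
    edist (E.simpleIntegral g x) (E.simpleIntegral h x) =
      eLpNorm (⇑g - ⇑h) 2 (E.scalarMeasure x) := by
  rw [edist_eq_enorm_sub, ← sub_apply, ← E.simpleIntegral_sub, E.enorm_simpleIntegral,
    SimpleFunc.coe_sub]

/-- Simple functions approximating `f`; they converge to `f` in every space `L²(E_x)` that
contains `f`. -/
noncomputable def approx (f : ℂ → ℂ) (hf : Measurable f) : ℕ → SimpleFunc ℂ ℂ :=
  SimpleFunc.approxOn f hf (range f ∪ {0}) 0 (by simp)

/-- The vector `(∫ f dE) x`, a junk value unless `f ∈ L²(E_x)`. -/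
noncomputable def spectralIntegral (f : ℂ → ℂ) (hf : Measurable f) (x : H) : H :=
  limUnder atTop fun n => E.simpleIntegral (approx f hf n) x

variable {f g : ℂ → ℂ} (hf : Measurable f) (hg : Measurable g) {x y : H}

theorem tendsto_eLpNorm_approx_sub {μ : Measure ℂ} (hfμ : MemLp f 2 μ) :
    Tendsto (fun n => eLpNorm (⇑(approx f hf n) - f) 2 μ) atTop (𝓝 0) :=
  SimpleFunc.tendsto_approxOn_range_Lp_eLpNorm (by simp) hf hfμ.2

theorem tendsto_toLp_approx {μ : Measure ℂ} [IsFiniteMeasure μ] (hfμ : MemLp f 2 μ) :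
    Tendsto (fun n => ((approx f hf n).memLp_of_isFiniteMeasure 2 μ).toLp) atTop (𝓝 hfμ.toLp) :=
  (Lp.tendsto_Lp_iff_tendsto_eLpNorm'' _ _ f hfμ).2 (tendsto_eLpNorm_approx_sub hf hfμ)

theorem tendsto_simpleIntegral_approx (hfx : MemLp f 2 (E.scalarMeasure x)) :
    Tendsto (fun n => E.simpleIntegral (approx f hf n) x) atTop
      (𝓝 (E.spectralIntegral f hf x)) := by
  refine tendsto_nhds_limUnder (cauchySeq_tendsto_of_complete ?_)
  simpa only [EMetric.cauchySeq_iff, E.edist_simpleIntegral, Lp.edist_toLp_toLp] using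
    (tendsto_toLp_approx hf hfx).cauchySeq

theorem tendsto_simpleIntegral (hfx : MemLp f 2 (E.scalarMeasure x)) {g : ℕ → SimpleFunc ℂ ℂ}
    (hg : Tendsto (fun n => eLpNorm (⇑(g n) - f) 2 (E.scalarMeasure x)) atTop (𝓝 0)) :
    Tendsto (fun n => E.simpleIntegral (g n) x) atTop (𝓝 (E.spectralIntegral f hf x)) := by
  have hlim := E.tendsto_simpleIntegral_approx hf hfx
  have happrox := tendsto_eLpNorm_approx_sub hf hfx
  rw [tendsto_iff_edist_tendsto_0] at hlim ⊢
  refine tendsto_of_tendsto_of_tendsto_of_le_of_le tendsto_const_nhds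
    (by simpa using (hg.add happrox).add hlim) (fun _ => zero_le) fun n => ?_
  refine (edist_triangle _ (E.simpleIntegral (approx f hf n) x) _).trans ?_
  gcongr
  rw [E.edist_simpleIntegral, ← sub_sub_sub_cancel_right _ _ f]
  exact eLpNorm_sub_le (by fun_prop) (by fun_prop) (by norm_num)

theorem enorm_spectralIntegral (hfx : MemLp f 2 (E.scalarMeasure x)) :
    ‖E.spectralIntegral f hf x‖ₑ = eLpNorm f 2 (E.scalarMeasure x) := by
  have h := (tendsto_toLp_approx hf hfx).enorm
  simp only [Lp.enorm_toLp, ← E.enorm_simpleIntegral] at h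
  exact tendsto_nhds_unique (E.tendsto_simpleIntegral_approx hf hfx).enorm h

theorem inner_spectralIntegral (hfx : MemLp f 2 (E.scalarMeasure x)) :
    ⟪x, E.spectralIntegral f hf x⟫_ℂ = ∫ z, f z ∂E.scalarMeasure x := by
  have hL1 : Tendsto (fun n => eLpNorm (⇑(approx f hf n) - f) 1 (E.scalarMeasure x)) atTop
      (𝓝 0) := by
    refine tendsto_of_tendsto_of_tendsto_of_le_of_le tendsto_const_nhds ?_ (fun _ => zero_le)
      fun n => eLpNorm_le_eLpNorm_mul_rpow_measure_univ one_le_two (by fun_prop)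
    simpa using ENNReal.Tendsto.mul_const (tendsto_eLpNorm_approx_sub hf hfx)
      (.inr (ENNReal.rpow_ne_top_of_nonneg (by norm_num) (measure_ne_top _ _)))
  refine tendsto_nhds_unique (tendsto_const_nhds.inner (E.tendsto_simpleIntegral_approx hf hfx)) ?_
  simp only [E.inner_simpleIntegral]
  exact tendsto_integral_of_L1' f hfx.1
    (.of_forall fun n => (approx f hf n).integrable_of_isFiniteMeasure) hL1

theorem spectralIntegral_sub (hfx : MemLp f 2 (E.scalarMeasure x))
    (hgx : MemLp g 2 (E.scalarMeasure x)) :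
    E.spectralIntegral (f - g) (hf.sub hg) x =
      E.spectralIntegral f hf x - E.spectralIntegral g hg x := by
  have hlim : Tendsto (fun n => E.simpleIntegral (approx f hf n - approx g hg n) x) atTop
      (𝓝 (E.spectralIntegral f hf x - E.spectralIntegral g hg x)) := by
    simpa only [simpleIntegral_sub, sub_apply] using
      (E.tendsto_simpleIntegral_approx hf hfx).sub (E.tendsto_simpleIntegral_approx hg hgx)
  refine tendsto_nhds_unique (E.tendsto_simpleIntegral _ (hfx.sub hgx) ?_) hlim
  refine tendsto_of_tendsto_of_tendsto_of_le_of_le tendsto_const_nhds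
    (by simpa using (tendsto_eLpNorm_approx_sub hf hfx).add (tendsto_eLpNorm_approx_sub hg hgx))
    (fun _ => zero_le) fun n => ?_
  rw [SimpleFunc.coe_sub, sub_sub_sub_comm]
  exact eLpNorm_sub_le (by fun_prop) (by fun_prop) (by norm_num)

theorem spectralIntegral_congr_ae (hfx : MemLp f 2 (E.scalarMeasure x))
    (hfg : f =ᵐ[E.scalarMeasure x] g) :
    E.spectralIntegral f hf x = E.spectralIntegral g hg x := by
  have h := E.enorm_spectralIntegral (hf.sub hg) (hfx.sub (hfx.ae_eq hfg))
  rw [E.spectralIntegral_sub hf hg hfx (hfx.ae_eq hfg), eLpNorm_congr_ae hfg.sub_eq,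
    eLpNorm_zero, enorm_eq_zero, sub_eq_zero] at h
  exact h

theorem spectralIntegral_simpleFunc (g : SimpleFunc ℂ ℂ) (x : H) :
    E.spectralIntegral g g.measurable x = E.simpleIntegral g x :=
  tendsto_nhds_unique (E.tendsto_simpleIntegral g.measurable (g := fun _ => g)
    (g.memLp_of_isFiniteMeasure 2 _) (by simp)) tendsto_const_nhds

theorem spectralIntegral_one (x : H) : E.spectralIntegral 1 measurable_one x = x := by
  have h := E.spectralIntegral_simpleFunc
    (.piecewise Set.univ .univ (.const ℂ 1) (.const ℂ 0)) x
  rw [E.simpleIntegral_piecewise, E.univ, one_smul] at h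
  simpa [SimpleFunc.piecewise_univ] using h

theorem simpleIntegral_spectralIntegral (g : SimpleFunc ℂ ℂ)
    (hfx : MemLp f 2 (E.scalarMeasure x)) :
    E.simpleIntegral g (E.spectralIntegral f hf x) =
      E.spectralIntegral (g * f) (g.measurable.mul hf) x := by
  obtain ⟨C, hC⟩ := g.exists_forall_norm_le
  have hbound {h : ℂ → ℂ} : ∀ᵐ z ∂E.scalarMeasure x, ‖(g * h) z‖ ≤ C * ‖h z‖ :=
    .of_forall fun z => by simpa using mul_le_mul_of_nonneg_right (hC z) (norm_nonneg (h z))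
  refine tendsto_nhds_unique (((E.simpleIntegral g).continuous.tendsto _).comp
    (E.tendsto_simpleIntegral_approx hf hfx)) ?_
  simp only [Function.comp_def, ← mul_apply_eq_comp, ← simpleIntegral_mul]
  refine E.tendsto_simpleIntegral _
    (.of_le_mul hfx (g.measurable.mul hf).aestronglyMeasurable hbound) ?_
  refine tendsto_of_tendsto_of_tendsto_of_le_of_le (h := fun n => ENNReal.ofReal C *
    eLpNorm (⇑(approx f hf n) - f) 2 (E.scalarMeasure x)) tendsto_const_nhds ?_
    (fun _ => zero_le) fun n => ?_
  · simpa using ENNReal.Tendsto.const_mul (tendsto_eLpNorm_approx_sub hf hfx)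
      (.inr ENNReal.ofReal_ne_top)
  · rw [SimpleFunc.coe_mul, ← mul_sub]
    exact eLpNorm_le_mul_eLpNorm_of_ae_le_mul hbound 2

theorem proj_spectralIntegral (hs : MeasurableSet s) (hfx : MemLp f 2 (E.scalarMeasure x)) :
    E.proj s (E.spectralIntegral f hf x) =
      E.spectralIntegral (s.indicator f) (hf.indicator hs) x := by
  have h := E.simpleIntegral_spectralIntegral hf
    (.piecewise s hs (.const ℂ 1) (.const ℂ 0)) hfx
  rw [E.simpleIntegral_piecewise, one_smul] at h
  rw [h]
  congr 1
  ext z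
  by_cases hz : z ∈ s <;> simp [hz]

theorem scalarMeasure_spectralIntegral (hfx : MemLp f 2 (E.scalarMeasure x)) :
    E.scalarMeasure (E.spectralIntegral f hf x) =
      (E.scalarMeasure x).withDensity fun z => ‖f z‖ₑ ^ 2 := by
  ext s hs
  rw [E.scalarMeasure_apply hs, E.proj_spectralIntegral hf hs hfx,
    E.enorm_spectralIntegral _ (hfx.indicator hs), sq_eLpNorm_two, withDensity_apply _ hs,
    ← lintegral_indicator hs]
  congr 1 with z
  by_cases hz : z ∈ s <;> simp [hz]

theorem eLpNorm_scalarMeasure_spectralIntegral (hg : Measurable g)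
    (hfx : MemLp f 2 (E.scalarMeasure x)) :
    eLpNorm g 2 (E.scalarMeasure (E.spectralIntegral f hf x)) =
      eLpNorm (g * f) 2 (E.scalarMeasure x) := by
  refine (ENNReal.pow_right_strictMono two_ne_zero).injective ?_
  simp only [sq_eLpNorm_two]
  rw [E.scalarMeasure_spectralIntegral hf hfx,
    lintegral_withDensity_eq_lintegral_mul _ (by fun_prop) (by fun_prop)]
  simp [mul_pow, mul_comm]

theorem memLp_scalarMeasure_spectralIntegral_iff (hg : Measurable g)
    (hfx : MemLp f 2 (E.scalarMeasure x)) :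
    MemLp g 2 (E.scalarMeasure (E.spectralIntegral f hf x)) ↔
      MemLp (g * f) 2 (E.scalarMeasure x) := by
  rw [MemLp, MemLp, E.eLpNorm_scalarMeasure_spectralIntegral hf hg hfx]
  exact and_congr_left' (iff_of_true hg.aestronglyMeasurable (hg.mul hf).aestronglyMeasurable)

theorem spectralIntegral_mul (hfx : MemLp f 2 (E.scalarMeasure x))
    (hgfx : MemLp (g * f) 2 (E.scalarMeasure x)) :
    E.spectralIntegral g hg (E.spectralIntegral f hf x) =
      E.spectralIntegral (g * f) (hg.mul hf) x := by
  have hg' := (E.memLp_scalarMeasure_spectralIntegral_iff hf hg hfx).2 hgfx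
  refine tendsto_nhds_unique (E.tendsto_simpleIntegral_approx hg hg') ?_
  simp only [E.simpleIntegral_spectralIntegral hf _ hfx]
  have hmem n : MemLp (⇑(approx g hg n) * f) 2 (E.scalarMeasure x) :=
    (E.memLp_scalarMeasure_spectralIntegral_iff hf (approx g hg n).measurable hfx).1
      ((approx g hg n).memLp_of_isFiniteMeasure 2 _)
  rw [tendsto_iff_edist_tendsto_0]
  refine (tendsto_eLpNorm_approx_sub hg hg').congr fun n => ?_
  rw [edist_eq_enorm_sub, ← E.spectralIntegral_sub _ _ (hmem n) hgfx,
    E.enorm_spectralIntegral _ ((hmem n).sub hgfx), ← sub_mul,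
    E.eLpNorm_scalarMeasure_spectralIntegral hf ((approx g hg n).measurable.sub hg) hfx]

theorem memLp_scalarMeasure_add (hf : Measurable f) (hfx : MemLp f 2 (E.scalarMeasure x))
    (hfy : MemLp f 2 (E.scalarMeasure y)) : MemLp f 2 (E.scalarMeasure (x + y)) := by
  rw [memLp_two_iff_lintegral hf] at *
  refine (lintegral_mono' (E.scalarMeasure_add_le x y) le_rfl).trans_lt ?_
  rw [lintegral_smul_measure, lintegral_add_measure]
  exact ENNReal.mul_lt_top (by simp) (ENNReal.add_lt_top.2 ⟨hfx, hfy⟩)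

theorem memLp_scalarMeasure_smul (a : ℂ) (hfx : MemLp f 2 (E.scalarMeasure x)) :
    MemLp f 2 (E.scalarMeasure (a • x)) := by
  rw [E.scalarMeasure_smul]
  exact hfx.smul_measure (by simp)

theorem spectralIntegral_add_right (hfx : MemLp f 2 (E.scalarMeasure x))
    (hfy : MemLp f 2 (E.scalarMeasure y)) :
    E.spectralIntegral f hf (x + y) = E.spectralIntegral f hf x + E.spectralIntegral f hf y := by
  refine tendsto_nhds_unique
    (E.tendsto_simpleIntegral_approx hf (E.memLp_scalarMeasure_add hf hfx hfy)) ?_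
  simpa only [map_add] using
    (E.tendsto_simpleIntegral_approx hf hfx).add (E.tendsto_simpleIntegral_approx hf hfy)

theorem spectralIntegral_smul_right (a : ℂ) (hfx : MemLp f 2 (E.scalarMeasure x)) :
    E.spectralIntegral f hf (a • x) = a • E.spectralIntegral f hf x := by
  refine tendsto_nhds_unique
    (E.tendsto_simpleIntegral_approx hf (E.memLp_scalarMeasure_smul a hfx)) ?_
  simpa only [map_smul] using (E.tendsto_simpleIntegral_approx hf hfx).const_smul a

/-- The operator `∫ f dE`, with domain `{x | f ∈ L²(E_x)}`. -/
noncomputable def integralOperator (f : ℂ → ℂ) (hf : Measurable f) : H →ₗ.[ℂ] H where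
  domain :=
    { carrier := {x | MemLp f 2 (E.scalarMeasure x)}
      zero_mem' := by simp [scalarMeasure_zero]
      add_mem' := E.memLp_scalarMeasure_add hf
      smul_mem' a _ := E.memLp_scalarMeasure_smul a }
  toFun :=
    { toFun x := E.spectralIntegral f hf x
      map_add' x y := E.spectralIntegral_add_right hf x.2 y.2
      map_smul' a x := E.spectralIntegral_smul_right hf a x.2 }

theorem isIntegral_integralOperator : E.IsIntegral f (E.integralOperator f hf) :=
  ⟨fun _ => memLp_two_iff_lintegral hf, fun x => E.inner_spectralIntegral hf x.2⟩

theorem memLp_scalarMeasure_proj_of_bounded (hf : Measurable f) (hs : MeasurableSet s) {C : ℝ}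
    (hC : ∀ z ∈ s, ‖f z‖ ≤ C) : MemLp f 2 (E.scalarMeasure (E.proj s x)) := by
  rw [E.scalarMeasure_proj hs]
  exact .of_bound hf.aestronglyMeasurable C (ae_restrict_of_forall_mem hs hC)

theorem eq_zero_of_forall_inner_eq_zero (hf : Measurable f)
    (hx : ∀ y, MemLp f 2 (E.scalarMeasure y) → ⟪y, x⟫_ℂ = 0) :
    x = 0 := by
  have hs (n : ℕ) : MeasurableSet {z | ‖f z‖ ≤ n} := measurableSet_le hf.norm measurable_const
  have hnull (n : ℕ) : E.scalarMeasure x {z | ‖f z‖ ≤ n} = 0 := by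
    have h := hx _ (E.memLp_scalarMeasure_proj_of_bounded hf (x := x) (hs n) fun _ hz => hz)
    rw [← inner_conj_symm, E.inner_proj_self (hs n)] at h
    rw [E.scalarMeasure_eq_zero_iff (hs n)]
    simpa using h
  have hUnion : ⋃ n : ℕ, {z | ‖f z‖ ≤ n} = Set.univ := by
    ext z; simpa using exists_nat_ge ‖f z‖
  have h := measure_iUnion_null hnull
  rw [hUnion, E.scalarMeasure_univ] at h
  simpa using h

variable {E} in
theorem IsIntegral.mem_domain_iff {A : H →ₗ.[ℂ] H} (hA : E.IsIntegral f A) (hf : Measurable f) :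
    x ∈ A.domain ↔ MemLp f 2 (E.scalarMeasure x) :=
  (hA.1 x).trans (memLp_two_iff_lintegral hf).symm

variable {E} in
theorem IsIntegral.ext (hf : Measurable f) {A B : H →ₗ.[ℂ] H} (hA : E.IsIntegral f A)
    (hB : E.IsIntegral f B) : A = B := by
  obtain ⟨D, S⟩ := A
  obtain ⟨D', T⟩ := B
  obtain rfl : D = D' := by ext x; exact (hA.1 x).trans (hB.1 x).symm
  have hdiag (x : D) : ⟪(x : H), (S - T) x⟫_ℂ = 0 := by
    rw [LinearMap.sub_apply, inner_sub_right, sub_eq_zero]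
    exact (hA.2 x).trans (hB.2 x).symm
  congr
  ext x
  refine sub_eq_zero.1 (E.eq_zero_of_forall_inner_eq_zero hf fun y hy => ?_)
  exact inner_map_eq_zero_of_inner_map_self_eq_zero hdiag ⟨y, (hA.mem_domain_iff hf).2 hy⟩ x

variable {E} in
theorem IsIntegral.apply_eq (hf : Measurable f) {A : H →ₗ.[ℂ] H} (hA : E.IsIntegral f A)
    (x : A.domain) : A x = E.spectralIntegral f hf x := by
  obtain rfl := hA.ext hf (E.isIntegral_integralOperator hf)
  rfl

variable {E} in
theorem IsIntegral.sub_constOp {A : H →ₗ.[ℂ] H} (hf : Measurable f) (hA : E.IsIntegral f A)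
    (a : ℂ) : E.IsIntegral (fun z => f z - a) (A - constOp H a) := by
  have hconst (x : H) : MemLp (fun _ => a) 2 (E.scalarMeasure x) := memLp_const a
  have hdom (x : H) : x ∈ (A - constOp H a).domain ↔ x ∈ A.domain := by
    simp [LinearPMap.sub_domain, constOp]
  refine ⟨fun x => ?_, fun x => ?_⟩
  · rw [hdom, hA.mem_domain_iff hf, ← memLp_two_iff_lintegral (by fun_prop)]
    exact ⟨fun h => h.sub (hconst x), fun h => by
      simpa [Pi.add_def] using h.add (hconst x)⟩
  · have hx := (hdom x).1 x.2
    rw [integral_sub (((hA.mem_domain_iff hf).1 hx).integrable one_le_two) (integrable_const a),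
      ← hA.2 ⟨x, hx⟩, LinearPMap.sub_apply, inner_sub_right]
    congr 1
    change ⟪(x : H), a • (x : H)⟫_ℂ = _
    rw [inner_smul_right, inner_self_eq_norm_sq_to_K, integral_const, Measure.real,
      E.scalarMeasure_univ]
    simp [mul_comm]

variable {E} in
theorem IsIntegral.smul {A : H →ₗ.[ℂ] H} (hf : Measurable f) (hA : E.IsIntegral f A)
    {a : ℂ} (ha : a ≠ 0) : E.IsIntegral (fun z => a * f z) (a • A) := by
  refine ⟨fun x => ?_, fun x => ?_⟩
  · rw [LinearPMap.smul_domain, hA.mem_domain_iff hf, ← memLp_two_iff_lintegral (by fun_prop)]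
    exact ⟨fun h => h.const_mul a, fun h => by simpa [ha] using! h.const_mul a⁻¹⟩
  · rw [integral_const_mul, ← hA.2 ⟨x, x.2⟩, ← inner_smul_right]
    rfl

variable {E} in
theorem IsIntegral.constOp_add {A : H →ₗ.[ℂ] H} (hf : Measurable f) (hA : E.IsIntegral f A)
    (a : ℂ) : E.IsIntegral (fun z => a + f z) (constOp H a + A) := by
  have h := hA.sub_constOp hf (-a)
  have hneg : constOp H (-a) = -constOp H a := LinearPMap.ext rfl fun x _ _ => neg_smul a x
  rw [hneg, sub_neg_eq_add, add_comm] at h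
  simpa [add_comm] using h

theorem norm_spectralIntegral_le {C : ℝ} (hC₀ : 0 ≤ C)
    (hC : ∀ᵐ z ∂E.scalarMeasure x, ‖f z‖ ≤ C) : ‖E.spectralIntegral f hf x‖ ≤ C * ‖x‖ := by
  have h := eLpNorm_le_of_ae_bound (p := 2) hC
  rw [← E.enorm_spectralIntegral hf (.of_bound hf.aestronglyMeasurable C hC),
    E.scalarMeasure_univ, ← ENNReal.rpow_natCast, ← ENNReal.rpow_mul] at h
  simpa [← ofReal_norm, ← ENNReal.ofReal_mul (norm_nonneg x), mul_comm,
    ENNReal.ofReal_le_ofReal_iff (mul_nonneg hC₀ (norm_nonneg x))] using h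

variable {E} in
theorem IsIntegral.exists_proj_eq_zero {A : H →ₗ.[ℂ] H} (hf : Measurable f)
    (hA : E.IsIntegral f A) (hinv : IsInvertible A) : ∃ d > 0, E.proj {z | ‖f z‖ < d} = 0 := by
  obtain ⟨B, -, -, hBA⟩ := hinv
  have hd : 0 < (‖B‖ + 1)⁻¹ := by positivity
  refine ⟨(‖B‖ + 1)⁻¹, hd, ?_⟩
  set s := {z | ‖f z‖ < (‖B‖ + 1)⁻¹}
  have hs : MeasurableSet s := measurableSet_lt hf.norm measurable_const
  ext x
  rw [zero_apply]
  have hmem := E.memLp_scalarMeasure_proj_of_bounded hf (x := x) hs fun z hz => le_of_lt hz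
  have hbound : ∀ᵐ z ∂E.scalarMeasure (E.proj s x), ‖f z‖ ≤ (‖B‖ + 1)⁻¹ := by
    rw [E.scalarMeasure_proj hs]
    exact ae_restrict_of_forall_mem hs fun z hz => le_of_lt hz
  have hle : ‖E.proj s x‖ ≤ ‖B‖ * ((‖B‖ + 1)⁻¹ * ‖E.proj s x‖) := by
    calc ‖E.proj s x‖ = ‖B (E.spectralIntegral f hf (E.proj s x))‖ := by
          rw [← hA.apply_eq hf ⟨_, (hA.mem_domain_iff hf).2 hmem⟩, hBA]
      _ ≤ ‖B‖ * ((‖B‖ + 1)⁻¹ * ‖E.proj s x‖) :=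
          B.le_opNorm_of_le (E.norm_spectralIntegral_le hf hd.le hbound)
  have hlt : ‖B‖ * (‖B‖ + 1)⁻¹ < 1 := by
    rw [← div_eq_mul_inv, div_lt_one (by positivity)]
    exact lt_add_one _
  rw [← norm_le_zero_iff]
  nlinarith [norm_nonneg (E.proj s x)]

theorem spectralIntegral_spectralIntegral_of_mul_ae_eq_one
    (hfx : MemLp f 2 (E.scalarMeasure x)) (hgf : g * f =ᵐ[E.scalarMeasure x] 1) :
    E.spectralIntegral g hg (E.spectralIntegral f hf x) = x := by
  have hone : MemLp (1 : ℂ → ℂ) 2 (E.scalarMeasure x) := memLp_const 1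
  rw [E.spectralIntegral_mul hf hg hfx (hone.ae_eq hgf.symm),
    ← E.spectralIntegral_congr_ae measurable_one _ hone hgf.symm, E.spectralIntegral_one]

variable {E} in
theorem IsIntegral.isInvertible_of_proj_eq_zero {A : H →ₗ.[ℂ] H} (hf : Measurable f)
    (hA : E.IsIntegral f A) {d : ℝ} (hd : 0 < d) (hE : E.proj {z | ‖f z‖ < d} = 0) :
    IsInvertible A := by
  have hfd (x : H) : ∀ᵐ z ∂E.scalarMeasure x, d ≤ ‖f z‖ := by
    simpa [ae_iff] using (E.proj_eq_zero_iff (measurableSet_lt hf.norm measurable_const)).1 hE x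
  have hinv_le (x : H) : ∀ᵐ z ∂E.scalarMeasure x, ‖f⁻¹ z‖ ≤ d⁻¹ := by
    filter_upwards [hfd x] with z hz
    simpa using inv_anti₀ hd hz
  have hinv_memLp (x : H) : MemLp f⁻¹ 2 (E.scalarMeasure x) :=
    .of_bound hf.inv.aestronglyMeasurable d⁻¹ (hinv_le x)
  have hmul_inv (x : H) : f * f⁻¹ =ᵐ[E.scalarMeasure x] 1 := by
    filter_upwards [hfd x] with z hz
    exact mul_inv_cancel₀ (norm_pos_iff.1 (hd.trans_le hz))
  let B : H →L[ℂ] H := LinearMap.mkContinuous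
    { toFun x := E.spectralIntegral f⁻¹ hf.inv x
      map_add' x y := E.spectralIntegral_add_right hf.inv (hinv_memLp x) (hinv_memLp y)
      map_smul' a x := E.spectralIntegral_smul_right hf.inv a (hinv_memLp x) }
    d⁻¹ fun x => E.norm_spectralIntegral_le hf.inv (inv_nonneg.2 hd.le) (hinv_le x)
  have hBA (v : A.domain) : B (A v) = v := by
    rw [hA.apply_eq hf]
    exact E.spectralIntegral_spectralIntegral_of_mul_ae_eq_one hf hf.inv
      ((hA.mem_domain_iff hf).1 v.2) (mul_comm f f⁻¹ ▸ hmul_inv v)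
  refine ⟨B, Subset.antisymm ?_ fun v hv => ⟨A ⟨v, hv⟩, hBA ⟨v, hv⟩⟩, fun u hu => ?_, hBA⟩
  · rintro - ⟨u, rfl⟩
    refine (hA.mem_domain_iff hf).2 ((E.memLp_scalarMeasure_spectralIntegral_iff hf.inv hf
      (hinv_memLp u)).2 (.ae_eq (hmul_inv u).symm (memLp_const 1)))
  · rw [hA.apply_eq hf]
    exact E.spectralIntegral_spectralIntegral_of_mul_ae_eq_one hf.inv hf (hinv_memLp u) (hmul_inv u)

variable {E} in
theorem IsIntegral.isInvertible_iff {A : H →ₗ.[ℂ] H} (hf : Measurable f)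
    (hA : E.IsIntegral f A) : IsInvertible A ↔ ∃ d > 0, E.proj {z | ‖f z‖ < d} = 0 :=
  ⟨hA.exists_proj_eq_zero hf, fun ⟨_, hd, hE⟩ => hA.isInvertible_of_proj_eq_zero hf hd hE⟩

/-! ### Support of a resolution of the identity and spectrum -/

/-- The support of `E`: the points all of whose neighbourhoods have a nonzero projection. -/
def support : Set ℂ := {l | ∀ r > 0, E.proj (Metric.ball l r) ≠ 0}

variable {E} in
theorem proj_eq_zero_of_subset (hs : MeasurableSet s) (ht : MeasurableSet t) (hst : s ⊆ t)
    (hE : E.proj t = 0) : E.proj s = 0 := by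
  rw [E.proj_eq_zero_iff ht] at hE
  exact (E.proj_eq_zero_iff hs).2 fun x => measure_mono_null hst (hE x)

variable {E} in
theorem proj_eq_zero_of_disjoint_support (hs : MeasurableSet s) (hd : Disjoint s E.support) :
    E.proj s = 0 := by
  refine (E.proj_eq_zero_iff hs).2 fun x => measure_null_of_locally_null s fun l hl => ?_
  obtain ⟨r, hr, hE⟩ : ∃ r > 0, E.proj (Metric.ball l r) = 0 := by
    simpa [support] using hd.notMem_of_mem_left hl
  exact ⟨_, mem_nhdsWithin_of_mem_nhds (Metric.ball_mem_nhds l hr),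
    (E.proj_eq_zero_iff Metric.isOpen_ball.measurableSet).1 hE x⟩

variable {E} in
theorem proj_eq_zero_iff_disjoint_support (hs : IsOpen s) :
    E.proj s = 0 ↔ Disjoint s E.support := by
  refine ⟨fun hE => Set.disjoint_left.2 fun l hl hlE => ?_,
    proj_eq_zero_of_disjoint_support hs.measurableSet⟩
  obtain ⟨r, hr, hrs⟩ := Metric.isOpen_iff.1 hs l hl
  exact hlE r hr (proj_eq_zero_of_subset Metric.isOpen_ball.measurableSet hs.measurableSet hrs hE)

theorem isClosed_support : IsClosed E.support := by
  rw [← isOpen_compl_iff, Metric.isOpen_iff]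
  intro l hl
  obtain ⟨r, hr, hE⟩ : ∃ r > 0, E.proj (Metric.ball l r) = 0 := by simpa [support] using hl
  exact ⟨r, hr, ((proj_eq_zero_iff_disjoint_support Metric.isOpen_ball).1 hE).subset_compl_right⟩

theorem support_map {h : ℂ → ℂ} (hh : Continuous h) :
    (E.map h hh.measurable).support = closure (h '' E.support) := by
  ext l
  refine Iff.trans (forall₂_congr fun r _ => ?_) Metric.mem_closure_iff.symm
  change E.proj (h ⁻¹' Metric.ball l r) ≠ 0 ↔ _
  rw [Ne, proj_eq_zero_iff_disjoint_support (Metric.isOpen_ball.preimage hh),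
    Set.not_disjoint_iff]
  simp only [exists_mem_image, mem_preimage, Metric.mem_ball, dist_comm l]
  exact exists_congr fun z => and_comm

theorem exists_pos_proj_eq_zero_iff (hf : Measurable f) (hcomp : IsCompact E.support)
    (hcont : ContinuousOn f E.support) :
    (∃ d > 0, E.proj {z | ‖f z‖ < d} = 0) ↔ ∀ z ∈ E.support, f z ≠ 0 := by
  have hlt (d : ℝ) : MeasurableSet {z | ‖f z‖ < d} := measurableSet_lt hf.norm measurable_const
  constructor
  · rintro ⟨d, hd, hE⟩ z hz hfz
    obtain ⟨r, hr, hball⟩ : ∃ r > 0, ∀ w ∈ E.support, dist w z < r → ‖f w‖ < d := by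
      simpa [hfz] using Metric.continuousWithinAt_iff.1 (hcont z hz) d hd
    refine hz r hr ((E.proj_eq_zero_iff Metric.isOpen_ball.measurableSet).2 fun x => ?_)
    have hcompl : E.proj E.supportᶜ = 0 :=
      proj_eq_zero_of_disjoint_support E.isClosed_support.measurableSet.compl disjoint_compl_left
    refine measure_mono_null (fun w hw => ?_) (measure_union_null
      ((E.proj_eq_zero_iff (hlt d)).1 hE x)
      ((E.proj_eq_zero_iff E.isClosed_support.measurableSet.compl).1 hcompl x))
    exact or_iff_not_imp_right.2 fun hwE => hball w (not_not.1 hwE) hw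
  · intro hne
    obtain ⟨d, hd, hle⟩ := hcomp.exists_forall_le' hcont.norm (a := 0) fun z hz =>
      norm_pos_iff.2 (hne z hz)
    exact ⟨d, hd, proj_eq_zero_of_disjoint_support (hlt d)
      (Set.disjoint_left.2 fun z hz hzE => (hle z hzE).not_gt hz)⟩

end ResolutionOfIdentity

/-- The spectrum of a possibly unbounded operator. -/
def operatorSpectrum (A : H →ₗ.[ℂ] H) : Set ℂ := {l | ¬ IsInvertible (A - constOp H l)}

variable {N : H →ₗ.[ℂ] H} {E : ResolutionOfIdentity H}

theorem ResolutionOfIdentity.IsIntegral.support_eq (hN : E.IsIntegral (fun z => z) N) :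
    E.support = operatorSpectrum N := by
  ext l
  have hinv := (hN.sub_constOp measurable_id l).isInvertible_iff (measurable_id.sub_const l)
  simp only [ResolutionOfIdentity.support, operatorSpectrum, mem_ofPred_eq, hinv, not_exists,
    not_and, Metric.ball, dist_eq_norm]
  rfl

theorem exists_isIntegral_functionalCalculus (hN : E.IsIntegral (fun z => z) N) {f : ℂ → ℂ}
    (hf : Measurable f) : ∃ E' : ResolutionOfIdentity H,
      E'.IsIntegral (fun z => z) N ∧ E'.IsIntegral f (functionalCalculus f N) := by
  have h : ∃ A, IsFunctionOf f N A := ⟨_, E, hN, E.isIntegral_integralOperator hf⟩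
  rw [functionalCalculus, dif_pos h]
  exact h.choose_spec

theorem isInvertible_functionalCalculus_iff (hN : E.IsIntegral (fun z => z) N) {f : ℂ → ℂ}
    (hf : Measurable f) (hcomp : IsCompact (operatorSpectrum N))
    (hcont : ContinuousOn f (operatorSpectrum N)) :
    IsInvertible (functionalCalculus f N) ↔ ∀ z ∈ operatorSpectrum N, f z ≠ 0 := by
  obtain ⟨E', hN', hA⟩ := exists_isIntegral_functionalCalculus hN hf
  rw [← hN'.support_eq] at hcomp hcont ⊢
  rw [hA.isInvertible_iff hf, E'.exists_pos_proj_eq_zero_iff hf hcomp hcont]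

end SpectralTheory

/-! ### Multiplication operators -/

section Multiplication

theorem hasSum_of_hasSum_norm_sq {ι H : Type*} [NormedAddCommGroup H] [InnerProductSpace ℂ H]
    {x : H} {y : ι → H} (hxy : ∀ i, ⟪x, y i⟫_ℂ = ‖y i‖ ^ 2)
    (hy : Pairwise fun i j => ⟪y i, y j⟫_ℂ = 0)
    (hsum : HasSum (fun i => ‖y i‖ ^ 2) (‖x‖ ^ 2)) : HasSum y x := by
  have hPythagoras (F : Finset ι) :
      ‖∑ i ∈ F, y i - x‖ ^ 2 = ‖x‖ ^ 2 - ∑ i ∈ F, ‖y i‖ ^ 2 := by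
    have hcross : ⟪x, ∑ i ∈ F, y i⟫_ℂ = ((∑ i ∈ F, ‖y i‖ ^ 2 : ℝ) : ℂ) := by
      simp [hxy]
    have hself : ⟪∑ i ∈ F, y i, ∑ i ∈ F, y i⟫_ℂ = ((∑ i ∈ F, ‖y i‖ ^ 2 : ℝ) : ℂ) := by
      rw [inner_sum, Complex.ofReal_sum]
      refine Finset.sum_congr rfl fun j hj => ?_
      rw [sum_inner, Finset.sum_eq_single_of_mem j hj fun i _ hij => hy hij,
        inner_self_eq_norm_sq_to_K]
      simp
    rw [norm_sub_sq (𝕜 := ℂ), ← inner_self_eq_norm_sq (𝕜 := ℂ), hself, inner_re_symm, hcross,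
      RCLike.re_eq_complex_re, Complex.ofReal_re]
    ring
  have hlim : Tendsto (fun F => ‖∑ i ∈ F, y i - x‖ ^ 2) atTop (𝓝 0) := by
    simp only [hPythagoras]
    exact sub_self (‖x‖ ^ 2) ▸ hsum.const_sub (‖x‖ ^ 2)
  rw [HasSum, SummationFilter.unconditional_filter, tendsto_iff_norm_sub_tendsto_zero]
  simpa using hlim.sqrt

variable {α : Type*} [MeasurableSpace α] {μ ν : Measure α}

/-- Multiplication by a function `w`, as a map between the `L²` spaces of two measures. -/
noncomputable def mulLp (w : α → ℂ) (hν : ν ≪ μ)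
    (hw : ∀ f : Lp ℂ 2 μ, MemLp (fun t => w t * f t) 2 ν) : Lp ℂ 2 μ →ₗ[ℂ] Lp ℂ 2 ν where
  toFun f := (hw f).toLp _
  map_add' f g := by
    rw [← MemLp.toLp_add (hw f) (hw g), MemLp.toLp_eq_toLp_iff]
    filter_upwards [hν.ae_le (Lp.coeFn_add f g)] with t ht
    simp only [ht, Pi.add_apply, mul_add]
  map_smul' a f := by
    rw [RingHom.id_apply, ← MemLp.toLp_const_smul a (hw f), MemLp.toLp_eq_toLp_iff]
    filter_upwards [hν.ae_le (Lp.coeFn_smul a f)] with t ht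
    simp only [ht, Pi.smul_apply, smul_eq_mul, mul_left_comm]

theorem coeFn_mulLp {w : α → ℂ} (hν : ν ≪ μ)
    (hw : ∀ f : Lp ℂ 2 μ, MemLp (fun t => w t * f t) 2 ν) (f : Lp ℂ 2 μ) :
    mulLp w hν hw f =ᵐ[ν] fun t => w t * f t :=
  MemLp.coeFn_toLp (hw f)

/-- Multiplication by a bounded measurable function, as a bounded operator on `L²`. -/
noncomputable def boundedMul (μ : Measure α) {w : α → ℂ} (hw : Measurable w) {C : ℝ}
    (hC : ∀ t, ‖w t‖ ≤ C) : Lp ℂ 2 μ →L[ℂ] Lp ℂ 2 μ :=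
  have hle (f : Lp ℂ 2 μ) (t : α) : ‖w t * f t‖ ≤ C * ‖f t‖ := by
    rw [norm_mul]
    gcongr
    exact hC t
  LinearMap.mkContinuous (mulLp w .rfl fun f => (Lp.memLp f).of_le_mul
    (hw.aestronglyMeasurable.mul (Lp.aestronglyMeasurable f)) (ae_of_all _ (hle f))) C fun f => by
    refine Lp.norm_le_mul_norm_of_ae_le_mul ?_
    filter_upwards [coeFn_mulLp .rfl _ f] with t ht
    rw [ht]
    exact hle f t

theorem coeFn_boundedMul {w : α → ℂ} (hw : Measurable w) {C : ℝ} (hC : ∀ t, ‖w t‖ ≤ C)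
    (f : Lp ℂ 2 μ) : boundedMul μ hw hC f =ᵐ[μ] fun t => w t * f t :=
  coeFn_mulLp .rfl _ f

/-- Multiplication by the indicator function of a measurable set, as an operator on `L²`. -/
noncomputable def indicatorMul (μ : Measure α) {s : Set α} (hs : MeasurableSet s) :
    Lp ℂ 2 μ →L[ℂ] Lp ℂ 2 μ :=
  boundedMul μ (measurable_one.indicator hs : Measurable (s.indicator (1 : α → ℂ)))
    fun z => (norm_indicator_le_norm_self 1 z).trans_eq norm_one

variable {s t : Set α} (hs : MeasurableSet s) (ht : MeasurableSet t) (f g : Lp ℂ 2 μ)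

theorem coeFn_indicatorMul : indicatorMul μ hs f =ᵐ[μ] s.indicator f := by
  refine (coeFn_boundedMul _ _ f).trans (ae_of_all _ fun z => ?_)
  by_cases hz : z ∈ s <;> simp [hz]

theorem indicatorMul_indicatorMul :
    indicatorMul μ hs (indicatorMul μ ht f) = indicatorMul μ (hs.inter ht) f := by
  refine Lp.ext ?_
  filter_upwards [coeFn_indicatorMul hs (indicatorMul μ ht f), coeFn_indicatorMul ht f,
    coeFn_indicatorMul (hs.inter ht) f] with z hst ht' hinter
  rw [hst, hinter, ← indicator_indicator]
  by_cases hz : z ∈ s <;> simp [hz, ht']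

theorem inner_indicatorMul_left :
    ⟪indicatorMul μ hs f, g⟫_ℂ = ⟪f, indicatorMul μ hs g⟫_ℂ := by
  rw [L2.inner_def, L2.inner_def]
  refine integral_congr_ae ?_
  filter_upwards [coeFn_indicatorMul hs f, coeFn_indicatorMul hs g] with z hf hg
  rw [hf, hg]
  by_cases hz : z ∈ s <;> simp [hz]

theorem inner_indicatorMul_self :
    ⟪f, indicatorMul μ hs f⟫_ℂ = ‖indicatorMul μ hs f‖ ^ 2 := by
  have h := indicatorMul_indicatorMul hs hs f
  simp only [inter_self] at h
  rw [← h, ← inner_indicatorMul_left, inner_self_eq_norm_sq_to_K, h]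
  rfl

theorem enorm_indicatorMul_sq : ‖indicatorMul μ hs f‖ₑ ^ 2 = ∫⁻ z in s, ‖f z‖ₑ ^ 2 ∂μ := by
  rw [Lp.enorm_def, eLpNorm_congr_ae (coeFn_indicatorMul hs f),
    eLpNorm_indicator_eq_eLpNorm_restrict hs, sq_eLpNorm_two]

theorem indicatorMul_empty : indicatorMul μ (.empty : MeasurableSet (∅ : Set α)) = 0 := by
  ext1 f
  refine Lp.ext ?_
  filter_upwards [coeFn_indicatorMul .empty f, Lp.coeFn_zero ℂ 2 μ] with z hz hz₀
  rw [hz, zero_apply, hz₀, indicator_empty, Pi.zero_apply]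

theorem indicatorMul_univ : indicatorMul μ (.univ : MeasurableSet (univ : Set α)) = 1 := by
  ext1 f
  refine Lp.ext ?_
  filter_upwards [coeFn_indicatorMul .univ f] with z hz
  rw [hz, one_apply_eq_self, indicator_univ]

theorem hasSum_indicatorMul_iUnion {s : ℕ → Set α} (hs : ∀ n, MeasurableSet (s n))
    (hd : Pairwise (Function.onFun Disjoint s)) :
    HasSum (fun n => indicatorMul μ (hs n) f) (indicatorMul μ (.iUnion hs) f) := by
  have hsub (n : ℕ) : indicatorMul μ (hs n) (indicatorMul μ (.iUnion hs) f) =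
      indicatorMul μ (hs n) f := by
    rw [indicatorMul_indicatorMul]
    simp only [inter_eq_self_of_subset_left (subset_iUnion s n)]
  have hsum : ∑' n, ENNReal.ofReal (‖indicatorMul μ (hs n) f‖ ^ 2) =
      ENNReal.ofReal (‖indicatorMul μ (.iUnion hs) f‖ ^ 2) := by
    simp only [ENNReal.ofReal_pow (norm_nonneg _), ofReal_norm, enorm_indicatorMul_sq]
    exact (lintegral_iUnion hs hd _).symm
  refine hasSum_of_hasSum_norm_sq (fun n => ?_) (fun i j hij => ?_) ?_
  · rw [← hsub, inner_indicatorMul_self]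
  · beta_reduce
    rw [inner_indicatorMul_left, indicatorMul_indicatorMul]
    simp only [disjoint_iff_inter_eq_empty.1 (hd hij), indicatorMul_empty, zero_apply,
      inner_zero_right]
  · rw [← ENNReal.toReal_ofReal (sq_nonneg ‖indicatorMul μ (.iUnion hs) f‖), ← hsum,
      ENNReal.tsum_toReal_eq fun _ => ENNReal.ofReal_ne_top]
    have hfin : ∑' n, ENNReal.ofReal (‖indicatorMul μ (hs n) f‖ ^ 2) ≠ ∞ :=
      hsum ▸ ENNReal.ofReal_ne_top
    simpa only [ENNReal.toReal_ofReal (sq_nonneg _)] using ENNReal.hasSum_toReal hfin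

open Classical in
/-- The resolution of the identity of the operator of multiplication by `m` on `L²`: the projection
of `s` is multiplication by the indicator function of `m ⁻¹' s`. -/
noncomputable def multiplicationResolution (μ : Measure α) (m : α → ℂ) (hm : Measurable m) :
    ResolutionOfIdentity (Lp ℂ 2 μ) where
  proj s := if hs : MeasurableSet s then indicatorMul μ (hm hs) else 0
  isStarProjection s hs := by
    rw [dif_pos hs]
    refine ⟨?_, ((ContinuousLinearMap.eq_adjoint_iff _ _).2
      (inner_indicatorMul_left (hm hs))).symm⟩
    ext1 f
    rw [mul_apply_eq_comp, indicatorMul_indicatorMul]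
    simp only [inter_self]
  empty := by rw [dif_pos .empty]; exact indicatorMul_empty
  univ := by rw [dif_pos .univ]; exact indicatorMul_univ
  inter s t hs ht := by
    rw [dif_pos hs, dif_pos ht, dif_pos (hs.inter ht)]
    ext1 f
    exact (indicatorMul_indicatorMul (hm hs) (hm ht) f).symm
  iUnion s hs hd f := by
    simp only [hs, MeasurableSet.iUnion hs, dite_true, preimage_iUnion]
    exact hasSum_indicatorMul_iUnion f (fun n => hm (hs n))
      fun i j hij => (hd hij).preimage m

variable {m : α → ℂ} (hm : Measurable m)

theorem proj_multiplicationResolution {s : Set ℂ} (hs : MeasurableSet s) :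
    (multiplicationResolution μ m hm).proj s = indicatorMul μ (hm hs) :=
  dif_pos hs

theorem scalarMeasure_multiplicationResolution :
    (multiplicationResolution μ m hm).scalarMeasure f =
      (μ.withDensity fun t => ‖f t‖ₑ ^ 2).map m := by
  ext s hs
  rw [ResolutionOfIdentity.scalarMeasure_apply _ hs, proj_multiplicationResolution hm hs,
    Measure.map_apply hm hs, withDensity_apply _ (hm hs), enorm_indicatorMul_sq]

theorem indicatorMul_eq_zero_iff [SigmaFinite μ] : indicatorMul μ hs = 0 ↔ μ s = 0 := by
  constructor
  · intro h₀
    by_contra hne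
    obtain ⟨t, ht, hts, ht₀, ht_top⟩ :=
      Measure.exists_subset_measure_lt_top hs (pos_iff_ne_zero.2 hne)
    refine ht₀.ne' (measure_eq_zero_iff_ae_notMem.2 ?_)
    have hmul := coeFn_indicatorMul hs (indicatorConstLp 2 ht ht_top.ne (1 : ℂ))
    rw [h₀, zero_apply] at hmul
    filter_upwards [hmul, Lp.coeFn_zero ℂ 2 μ,
      indicatorConstLp_coeFn (p := 2) (hs := ht) (hμs := ht_top.ne) (c := (1 : ℂ))]
      with z hz hz₀ hzt hzmem
    rw [hz₀, indicator_of_mem (hts hzmem), hzt, indicator_of_mem hzmem] at hz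
    exact zero_ne_one hz
  · intro h₀
    ext1 f
    have h := enorm_indicatorMul_sq hs f
    rw [Measure.restrict_eq_zero.2 h₀, lintegral_zero_measure] at h
    simpa using h

theorem support_multiplicationResolution [TopologicalSpace α] [OpensMeasurableSpace α]
    [SigmaFinite μ] [μ.IsOpenPosMeasure] (hm : Continuous m) :
    (multiplicationResolution μ m hm.measurable).support = closure (range m) := by
  ext l
  simp only [ResolutionOfIdentity.support, mem_ofPred_eq, Metric.mem_closure_range_iff]
  refine forall₂_congr fun r _ => ?_
  rw [proj_multiplicationResolution _ Metric.isOpen_ball.measurableSet, Ne,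
    indicatorMul_eq_zero_iff, (Metric.isOpen_ball.preimage hm).measure_eq_zero_iff μ,
    ← Ne, ← nonempty_iff_ne_empty]
  simp [Set.Nonempty, dist_comm]

variable {H K : Type*} [NormedAddCommGroup H] [InnerProductSpace ℂ H] [CompleteSpace H]
  [NormedAddCommGroup K] [InnerProductSpace ℂ K] [CompleteSpace K]

namespace ResolutionOfIdentity

/-- Transport of a resolution of the identity along a unitary map. -/
noncomputable def comap (E : ResolutionOfIdentity K) (W : H ≃ₗᵢ[ℂ] K) :
    ResolutionOfIdentity H where
  proj s := W.symm.conjStarAlgEquiv (E.proj s)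
  isStarProjection s hs := (E.isStarProjection s hs).map W.symm.conjStarAlgEquiv
  empty := by rw [E.empty, map_zero]
  univ := by rw [E.univ, map_one]
  inter s t hs ht := by rw [E.inter s t hs ht, map_mul]
  iUnion s hs hd x :=
    (E.iUnion s hs hd (W x)).mapL (W.symm.toContinuousLinearEquiv : K →L[ℂ] H)

variable (E : ResolutionOfIdentity K) (W : H ≃ₗᵢ[ℂ] K)

theorem scalarMeasure_comap (x : H) : (E.comap W).scalarMeasure x = E.scalarMeasure (W x) := by
  ext s hs
  rw [scalarMeasure_apply _ hs, scalarMeasure_apply _ hs]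
  exact congrArg (· ^ 2) (W.symm.enorm_map _)

theorem support_comap : (E.comap W).support = E.support := by
  simp only [support, comap, ne_eq, EmbeddingLike.map_eq_zero_iff]

end ResolutionOfIdentity

theorem isIntegral_comap_multiplicationResolution (W : H ≃ₗᵢ[ℂ] Lp ℂ 2 μ) {N : H →ₗ.[ℂ] H}
    (hN : ∀ x y, (x, y) ∈ N.graph ↔ W y =ᵐ[μ] fun t => m t * W x t) :
    ((multiplicationResolution μ m hm).comap W).IsIntegral (fun z => z) N := by
  have hmul (f : Lp ℂ 2 μ) : AEStronglyMeasurable (fun t => m t * f t) μ :=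
    hm.aestronglyMeasurable.mul (Lp.aestronglyMeasurable f)
  have hdens (f : Lp ℂ 2 μ) : AEMeasurable (fun t => ‖f t‖ₑ ^ 2) μ :=
    (Lp.aestronglyMeasurable f).enorm.pow_const 2
  refine ⟨fun x => ?_, fun x => ?_⟩
  · have hlint : ∫⁻ z, ‖z‖ₑ ^ 2 ∂(multiplicationResolution μ m hm).scalarMeasure (W x) =
        eLpNorm (fun t => m t * W x t) 2 μ ^ 2 := by
      rw [scalarMeasure_multiplicationResolution, lintegral_map (by fun_prop) hm,
        lintegral_withDensity_eq_lintegral_mul₀ (hdens (W x)) (by fun_prop), sq_eLpNorm_two]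
      simp [enorm_mul, mul_pow, mul_comm]
    rw [ResolutionOfIdentity.scalarMeasure_comap, hlint, ENNReal.pow_lt_top_iff,
      or_iff_left two_ne_zero, LinearPMap.mem_domain_iff]
    simp only [hN]
    refine ⟨fun ⟨y, hy⟩ => (eLpNorm_congr_ae hy) ▸ Lp.eLpNorm_lt_top (W y), fun h => ?_⟩
    refine ⟨W.symm (MemLp.toLp _ ⟨hmul (W x), h⟩), ?_⟩
    rw [W.apply_symm_apply]
    exact MemLp.coeFn_toLp _
  · rw [ResolutionOfIdentity.scalarMeasure_comap, scalarMeasure_multiplicationResolution,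
      integral_map hm.aemeasurable (by fun_prop),
      integral_withDensity_eq_integral_toReal_smul₀ (hdens (W x)) (by simp),
      ← W.inner_map_map, L2.inner_def]
    refine integral_congr_ae ?_
    filter_upwards [(hN x (N x)).1 (N.mem_graph x)] with t ht
    rw [ht, RCLike.inner_apply, ENNReal.toReal_pow, toReal_enorm, Complex.real_smul, mul_assoc,
      Complex.mul_conj, Complex.normSq_eq_norm_sq, mul_comm]

end Multiplication

/-! ### Weak derivatives -/

section WeakDerivative

theorem absolutelyContinuousOnInterval_integral {f : ℝ → ℂ} (hf : LocallyIntegrable f volume)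
    (c a b : ℝ) : AbsolutelyContinuousOnInterval (fun x => ∫ t in c..x, f t) a b := by
  have hint (x y : ℝ) : IntervalIntegrable f volume x y :=
    intervalIntegrable_iff.2 ((hf.integrableOn_isCompact isCompact_uIcc).mono_set uIoc_subset_uIcc)
  have hpart (L : ℂ →L[ℝ] ℝ) :
      AbsolutelyContinuousOnInterval (fun x => ∫ t in a..x, L (f t)) a b :=
    IntervalIntegrable.absolutelyContinuousOnInterval_intervalIntegral
      (intervalIntegrable_iff.2 (L.integrable_comp (intervalIntegrable_iff.1 (hint a b))))
      left_mem_uIcc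
  have hconst (z : ℂ) : AbsolutelyContinuousOnInterval (fun _ : ℝ => z) a b :=
    (LipschitzWith.const z).lipschitzOnWith.absolutelyContinuousOnInterval
  convert! (hconst (∫ t in c..a, f t)).add
    (((hpart Complex.reCLM).smul (hconst 1)).add ((hpart Complex.imCLM).smul (hconst Complex.I)))
    using 1
  ext x
  have hre := Complex.reCLM.intervalIntegral_comp_comm (hint a x)
  have him := Complex.imCLM.intervalIntegral_comp_comm (hint a x)
  simp only [Pi.add_apply, Pi.smul_apply', hre, him]
  simp only [Complex.reCLM_apply, Complex.imCLM_apply, Complex.real_smul, mul_one,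
    Complex.re_add_im, intervalIntegral.integral_add_adjacent_intervals (hint c a) (hint a x)]

/-- The weak derivative on `L²(ℝ)`, as a relation: `k` is the almost everywhere derivative of a
locally absolutely continuous representative of `g`. -/
def IsAEDeriv (g k : Lp ℂ 2 (volume : Measure ℝ)) : Prop :=
  ∃ F : ℝ → ℂ, (∀ a b : ℝ, AbsolutelyContinuousOnInterval F a b) ∧ (∀ᵐ t, g t = F t) ∧
    ∀ᵐ t, HasDerivAt F (k t) t

theorem isAEDeriv_iff_exists_integral {g k : Lp ℂ 2 (volume : Measure ℝ)} :
    IsAEDeriv g k ↔ ∃ C : ℂ, ∀ᵐ t, g t = C + ∫ s in (0 : ℝ)..t, k s := by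
  have hk : LocallyIntegrable k volume := (Lp.memLp k).locallyIntegrable one_le_two
  have hAC := absolutelyContinuousOnInterval_integral hk 0
  have hderiv := LocallyIntegrable.ae_hasDerivAt_integral hk
  constructor
  · rintro ⟨F, hF, hgF, hF'⟩
    have hF_eq (t : ℝ) : F t = F 0 + ∫ s in (0 : ℝ)..t, k s := by
      have hzero : ∀ᵐ x, x ∈ uIcc 0 t →
          HasDerivAt (F - fun x => ∫ s in (0 : ℝ)..x, k s) 0 x := by
        filter_upwards [hF', hderiv] with x hx hx' _
        simpa using hx.sub (hx' 0)
      obtain ⟨C, hC⟩ := ((hF 0 t).sub (hAC 0 t)).const_of_ae_hasDerivAt_zero hzero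
      have h := (hC t right_mem_uIcc).trans (hC 0 left_mem_uIcc).symm
      simp only [Pi.sub_apply, intervalIntegral.integral_same, sub_zero] at h
      exact sub_eq_iff_eq_add.1 h
    exact ⟨F 0, hgF.mono fun t ht => ht.trans (hF_eq t)⟩
  · rintro ⟨C, hC⟩
    exact ⟨_, fun a b =>
      (LipschitzWith.const C).lipschitzOnWith.absolutelyContinuousOnInterval.add (hAC a b),
      hC, hderiv.mono fun t ht => (ht 0).const_add C⟩

theorem tendsto_intervalIntegral_of_tendsto_Lp {k : ℕ → Lp ℂ 2 (volume : Measure ℝ)}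
    {l : Lp ℂ 2 (volume : Measure ℝ)} (h : Tendsto k atTop (𝓝 l)) (a b : ℝ) :
    Tendsto (fun n => ∫ t in a..b, k n t) atTop (𝓝 (∫ t in a..b, l t)) := by
  have hIoc (x y : ℝ) :
      Tendsto (fun n => ∫ t in Ioc x y, k n t) atTop (𝓝 (∫ t in Ioc x y, l t)) := by
    simp only [← L2.inner_indicatorConstLp_one (𝕜 := ℂ) measurableSet_Ioc
      (measure_Ioc_lt_top (a := x) (b := y)).ne]
    exact tendsto_const_nhds.inner h
  exact (hIoc a b).sub (hIoc b a)

theorem isClosed_setOf_isAEDeriv :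
    IsClosed {p : Lp ℂ 2 (volume : Measure ℝ) × Lp ℂ 2 (volume : Measure ℝ) |
      IsAEDeriv p.1 p.2} := by
  refine IsSeqClosed.isClosed fun p q hp hq => ?_
  simp only [mem_ofPred_eq, isAEDeriv_iff_exists_integral] at hp ⊢
  choose C hC using hp
  obtain ⟨n, hn, hlim⟩ := (tendstoInMeasure_of_tendsto_Lp
    ((continuous_fst.tendsto q).comp hq)).exists_seq_tendsto_ae
  have hint (t : ℝ) : Tendsto (fun i => ∫ s in (0 : ℝ)..t, (p (n i)).2 s) atTop
      (𝓝 (∫ s in (0 : ℝ)..t, q.2 s)) :=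
    (tendsto_intervalIntegral_of_tendsto_Lp ((continuous_snd.tendsto q).comp hq) 0 t).comp
      hn.tendsto_atTop
  have hC_lim : ∀ᵐ t, Tendsto (fun i => C (n i)) atTop
      (𝓝 (q.1 t - ∫ s in (0 : ℝ)..t, q.2 s)) := by
    filter_upwards [hlim, ae_all_iff.2 fun i => hC (n i)] with t ht ht'
    refine (ht.sub (hint t)).congr fun i => ?_
    exact sub_eq_iff_eq_add.2 (ht' i)
  obtain ⟨t₀, ht₀⟩ := hC_lim.exists
  exact ⟨_, hC_lim.mono fun t ht => sub_eq_iff_eq_add.1 (tendsto_nhds_unique ht ht₀)⟩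

theorem IsAEDeriv.sub {g g' k k' : Lp ℂ 2 (volume : Measure ℝ)} (h : IsAEDeriv g k)
    (h' : IsAEDeriv g' k') : IsAEDeriv (g - g') (k - k') := by
  obtain ⟨F, hF, hgF, hF'⟩ := h
  obtain ⟨G, hG, hgG, hG'⟩ := h'
  refine ⟨F - G, fun a b => (hF a b).sub (hG a b), ?_, ?_⟩
  · filter_upwards [hgF, hgG, Lp.coeFn_sub g g'] with t hF hG hsub
    rw [hsub, Pi.sub_apply, hF, hG, Pi.sub_apply]
  · filter_upwards [hF', hG', Lp.coeFn_sub k k'] with t hF hG hsub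
    rw [hsub]
    exact hF.sub hG

theorem absolutelyContinuousOnInterval_exp_smul {F : ℝ → ℂ} {a b : ℝ}
    (hF : AbsolutelyContinuousOnInterval F a b) (c : ℝ) :
    AbsolutelyContinuousOnInterval (fun t => Real.exp (c * t) • F t) a b :=
  have hexp : AbsolutelyContinuousOnInterval (fun t => Real.exp (c * t)) a b :=
    ContDiffOn.absolutelyContinuousOnInterval (by fun_prop)
  hexp.smul hF

theorem hasDerivAt_exp_smul {F : ℝ → ℂ} {k : ℂ} {t : ℝ} (c : ℝ) (h : HasDerivAt F k t) :
    HasDerivAt (fun t => Real.exp (c * t) • F t) (Real.exp (c * t) • (k + c * F t)) t := by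
  have hexp : HasDerivAt (fun t => Real.exp (c * t)) (Real.exp (c * t) * c) t := by
    simpa using ((hasDerivAt_id t).const_mul c).exp
  convert! hexp.smul h using 1
  simp only [Complex.real_smul]
  push_cast
  ring

theorem not_memLp_exp_neg_smul {z : ℂ} (hz : z ≠ 0) :
    ¬MemLp (fun t : ℝ => Real.exp (-t) • z) 2 volume := by
  intro h
  have hle : ∫⁻ _ in Iic (0 : ℝ), ‖z‖ₑ ^ 2 ≤ ∫⁻ t : ℝ, ‖Real.exp (-t) • z‖ₑ ^ 2 := by
    refine le_trans ?_ (setLIntegral_le_lintegral (Iic 0) _)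
    refine setLIntegral_mono' measurableSet_Iic fun t ht => ?_
    rw [enorm_smul]
    gcongr
    refine le_mul_of_one_le_left zero_le ?_
    rw [Real.enorm_of_nonneg (Real.exp_pos _).le, ENNReal.one_le_ofReal]
    exact Real.one_le_exp (neg_nonneg.2 ht)
  rw [setLIntegral_const, Real.volume_Iic, ENNReal.mul_top (by simpa using hz), top_le_iff,
    ← sq_eLpNorm_two] at hle
  exact ENNReal.pow_ne_top h.2.ne hle

theorem IsAEDeriv.eq_zero_of_add_eq_zero {g k : Lp ℂ 2 (volume : Measure ℝ)} (h : IsAEDeriv g k)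
    (hgk : g + k = 0) : g = 0 := by
  obtain ⟨F, hF, hgF, hF'⟩ := h
  have hderiv : ∀ᵐ t, HasDerivAt (fun t => Real.exp (1 * t) • F t) 0 t := by
    filter_upwards [hgF, hF', Lp.coeFn_neg g] with t hg hk hneg
    have h := hasDerivAt_exp_smul 1 hk
    rw [eq_neg_of_add_eq_zero_right hgk, hneg, Pi.neg_apply, hg] at h
    simpa using h
  have hF_eq (t : ℝ) : F t = Real.exp (-t) • F 0 := by
    obtain ⟨C, hC⟩ :=
      (absolutelyContinuousOnInterval_exp_smul (hF 0 t) 1).const_of_ae_hasDerivAt_zero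
        (hderiv.mono fun x hx _ => hx)
    have h := (hC t right_mem_uIcc).trans (hC 0 left_mem_uIcc).symm
    simp only [one_mul, Real.exp_zero, one_smul] at h
    rw [← h, smul_smul, ← Real.exp_add, neg_add_cancel, Real.exp_zero, one_smul]
  have hg : ∀ᵐ t, g t = Real.exp (-t) • F 0 := hgF.mono fun t ht => ht.trans (hF_eq t)
  have hF₀ : F 0 = 0 := by
    by_contra hne
    exact not_memLp_exp_neg_smul hne ((memLp_congr_ae hg).1 (Lp.memLp g))
  exact (Lp.eq_zero_iff_ae_eq_zero).2 (hg.mono fun t ht => by simpa [hF₀] using ht)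

end WeakDerivative

/-! ### The weak derivative as a Fourier multiplier -/

section FourierDerivative

open SchwartzMap FourierTransform
open scoped LineDeriv Real

/-- The Fourier multiplier of `(1 + d/dt)⁻¹`, which is bounded on `L²(ℝ)` and preserves Schwartz
functions. -/
noncomputable def resolventSymbol (ξ : ℝ) : ℂ := (1 + 2 * π * Complex.I * ξ)⁻¹

theorem one_add_two_pi_I_mul_ne_zero (ξ : ℝ) : 1 + 2 * π * Complex.I * (ξ : ℂ) ≠ 0 :=
  fun h => by simpa using congrArg Complex.re h

theorem norm_resolventSymbol_le (ξ : ℝ) : ‖resolventSymbol ξ‖ ≤ 1 := by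
  rw [resolventSymbol, norm_inv]
  refine inv_le_one_of_one_le₀ ?_
  simpa using Complex.abs_re_le_norm (1 + 2 * π * Complex.I * (ξ : ℂ))

theorem measurable_resolventSymbol : Measurable resolventSymbol := by
  unfold resolventSymbol
  fun_prop

theorem two_pi_I_mul_resolventSymbol (ξ : ℝ) :
    2 * π * Complex.I * ξ * resolventSymbol ξ = 1 - resolventSymbol ξ := by
  rw [resolventSymbol]
  field_simp [one_add_two_pi_I_mul_ne_zero ξ]
  ring

theorem hasTemperateGrowth_resolventSymbol : resolventSymbol.HasTemperateGrowth := by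
  have h_eq : resolventSymbol = fun ξ : ℝ =>
      (1 + ‖2 * π * ξ‖ ^ 2) ^ (-1 : ℝ) • (1 - 2 * π * Complex.I * (ξ : ℂ)) := by
    ext ξ
    rw [resolventSymbol, inv_eq_iff_eq_inv]
    refine eq_inv_of_mul_eq_one_right ?_
    rw [Real.rpow_neg_one, smul_mul_assoc, inv_smul_eq_iff₀ (by positivity), Complex.real_smul,
      Real.norm_eq_abs, sq_abs]
    push_cast
    linear_combination -4 * π ^ 2 * ξ ^ 2 * Complex.I_sq
  have hrpow : (fun ξ : ℝ => (1 + ‖ξ‖ ^ 2) ^ (-1 : ℝ)).HasTemperateGrowth := by fun_prop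
  rw [h_eq]
  exact (hrpow.comp (f := fun ξ : ℝ => 2 * π * ξ) (by fun_prop)).smul (by fun_prop)

/-- The operator `(1 + d/dt)⁻¹` on the Fourier side: multiplication by its symbol. -/
noncomputable def resolventMul : Lp ℂ 2 (volume : Measure ℝ) →L[ℂ] Lp ℂ 2 (volume : Measure ℝ) :=
  boundedMul volume measurable_resolventSymbol norm_resolventSymbol_le

theorem coeFn_resolventMul (u : Lp ℂ 2 (volume : Measure ℝ)) :
    resolventMul u =ᵐ[volume] fun ξ => resolventSymbol ξ * u ξ :=
  coeFn_boundedMul _ _ u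

theorem resolventMul_toLp (p : 𝓢(ℝ, ℂ)) :
    resolventMul (p.toLp 2 volume) = (smulLeftCLM ℂ resolventSymbol p).toLp 2 volume := by
  refine Lp.ext ?_
  filter_upwards [coeFn_resolventMul (p.toLp 2 volume), p.coeFn_toLp 2 volume,
    (smulLeftCLM ℂ resolventSymbol p).coeFn_toLp 2 volume] with ξ hmul hp hsmul
  rw [hmul, hp, hsmul, smulLeftCLM_apply_apply hasTemperateGrowth_resolventSymbol, smul_eq_mul]

theorem isAEDeriv_toLp (f : 𝓢(ℝ, ℂ)) :
    IsAEDeriv (f.toLp 2 volume) ((∂_{(1 : ℝ)} f).toLp 2 volume) := by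
  refine ⟨f, fun a b => ContDiffOn.absolutelyContinuousOnInterval (f.smooth 1).contDiffOn,
    f.coeFn_toLp 2 volume, ?_⟩
  filter_upwards [(∂_{(1 : ℝ)} f).coeFn_toLp 2 volume] with t ht
  rw [ht, lineDerivOp_apply_eq_fderiv, fderiv_apply_one_eq_deriv]
  exact f.differentiableAt.hasDerivAt

theorem lineDerivOp_fourierInv_smulLeftCLM_resolventSymbol (p : 𝓢(ℝ, ℂ)) :
    ∂_{(1 : ℝ)} (𝓕⁻ (smulLeftCLM ℂ resolventSymbol p)) =
      𝓕⁻ (p - smulLeftCLM ℂ resolventSymbol p) := by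
  rw [lineDerivOp_fourierInv_eq]
  congr 1
  ext ξ
  have hinner : (fun ξ : ℝ => inner ℝ ξ (1 : ℝ)).HasTemperateGrowth := by fun_prop
  rw [smul_apply, smulLeftCLM_apply_apply hinner, sub_apply,
    smulLeftCLM_apply_apply hasTemperateGrowth_resolventSymbol]
  simp only [RCLike.inner_apply, conj_trivial, one_mul, Complex.real_smul, smul_eq_mul]
  linear_combination p ξ * two_pi_I_mul_resolventSymbol ξ

theorem isAEDeriv_fourierInv_resolventMul (u : Lp ℂ 2 (volume : Measure ℝ)) :
    IsAEDeriv (𝓕⁻ (resolventMul u)) (𝓕⁻ (u - resolventMul u)) := by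
  let finv := (Lp.fourierTransformₗᵢ ℝ ℂ).symm
  have hclosed : IsClosed {u : Lp ℂ 2 (volume : Measure ℝ) |
      IsAEDeriv (finv (resolventMul u)) (finv (u - resolventMul u))} :=
    isClosed_setOf_isAEDeriv.preimage
      (f := fun u => (finv (resolventMul u), finv (u - resolventMul u)))
      ((finv.continuous.comp resolventMul.continuous).prodMk
        (finv.continuous.comp (continuous_id.sub resolventMul.continuous)))
  refine (SchwartzMap.denseRange_toLpCLM (E := ℝ) (F := ℂ) (μ := volume) (p := 2)
    ENNReal.ofNat_ne_top).induction_on u hclosed fun p => ?_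
  have h := isAEDeriv_toLp (𝓕⁻ (smulLeftCLM ℂ resolventSymbol p))
  rw [lineDerivOp_fourierInv_smulLeftCLM_resolventSymbol, ← toLp_fourierInv_eq,
    ← toLp_fourierInv_eq, ← toLpCLM_apply (𝕜 := ℝ) (f := p - _), map_sub, toLpCLM_apply,
    toLpCLM_apply, ← resolventMul_toLp] at h
  exact h

theorem isAEDeriv_iff_resolventMul {g k : Lp ℂ 2 (volume : Measure ℝ)} :
    IsAEDeriv g k ↔ resolventMul (𝓕 (g + k)) = 𝓕 g := by
  let f := Lp.fourierTransformₗᵢ ℝ ℂ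
  have hsolve : IsAEDeriv (f.symm (resolventMul (f (g + k))))
      (g + k - f.symm (resolventMul (f (g + k)))) := by
    have h := isAEDeriv_fourierInv_resolventMul (f (g + k))
    have hsub : f.symm (f (g + k) - resolventMul (f (g + k))) =
        g + k - f.symm (resolventMul (f (g + k))) := by
      rw [map_sub, f.symm_apply_apply]
    exact hsub ▸ h
  change _ ↔ resolventMul (f (g + k)) = f g
  rw [← f.symm_apply_eq]
  constructor
  · intro h
    exact (sub_eq_zero.1 ((h.sub hsolve).eq_zero_of_add_eq_zero (by abel))).symm
  · intro h
    rwa [h, add_sub_cancel_left] at hsolve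

theorem resolventMul_add_eq_iff {u v : Lp ℂ 2 (volume : Measure ℝ)} :
    resolventMul (u + v) = u ↔ v =ᵐ[volume] fun ξ => 2 * π * Complex.I * ξ * u ξ := by
  rw [Lp.ext_iff]
  refine eventually_congr ?_
  filter_upwards [coeFn_resolventMul (u + v), Lp.coeFn_add u v] with ξ hmul hadd
  rw [hmul, hadd, Pi.add_apply, resolventSymbol,
    inv_mul_eq_iff_eq_mul₀ (one_add_two_pi_I_mul_ne_zero ξ), add_mul, one_mul, add_right_inj]

theorem isAEDeriv_iff_fourier {g k : Lp ℂ 2 (volume : Measure ℝ)} :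
    IsAEDeriv g k ↔ (𝓕 k : Lp ℂ 2 volume) =ᵐ[volume]
      fun ξ : ℝ => 2 * π * Complex.I * ξ * (𝓕 g : Lp ℂ 2 volume) ξ := by
  have hadd : 𝓕 (g + k) = 𝓕 g + 𝓕 k := (Lp.fourierTransformₗᵢ ℝ ℂ).map_add g k
  rw [isAEDeriv_iff_resolventMul, hadd, resolventMul_add_eq_iff]

end FourierDerivative

/-! ### The spectral measure of the momentum operator -/

section Momentum

open FourierTransform
open scoped Real

variable (c : ℝ)

theorem ae_weightMeasure_iff {p : ℝ → Prop} : (∀ᵐ t ∂weightMeasure c, p t) ↔ ∀ᵐ t, p t :=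
  ⟨fun h => (volume_absolutelyContinuous_weightMeasure c).ae_le h,
    fun h => (withDensity_absolutelyContinuous _ _).ae_le h⟩

theorem eLpNorm_exp_mul {f : ℝ → ℂ} (hf : AEStronglyMeasurable f volume) :
    eLpNorm (fun t => (Real.exp (-c * t) : ℂ) * f t) 2 volume =
      eLpNorm f 2 (weightMeasure c) := by
  refine ENNReal.pow_right_strictMono two_ne_zero |>.injective ?_
  rw [sq_eLpNorm_two, sq_eLpNorm_two, weightMeasure,
    lintegral_withDensity_eq_lintegral_mul₀ (by fun_prop) (hf.enorm.pow_const 2)]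
  refine lintegral_congr fun t => ?_
  have hexp : ‖(Real.exp (-c * t) : ℂ)‖ₑ ^ 2 = ENNReal.ofReal (Real.exp (-2 * c * t)) := by
    rw [← ofReal_norm, Complex.norm_real, Real.norm_of_nonneg (Real.exp_pos _).le,
      ← ENNReal.ofReal_pow (Real.exp_pos _).le, ← Real.exp_nat_mul]
    ring_nf
  rw [Pi.mul_apply, enorm_mul, mul_pow, hexp]

theorem memLp_weightMeasure_iff {f : ℝ → ℂ} (hf : AEStronglyMeasurable f volume) :
    MemLp f 2 (weightMeasure c) ↔ MemLp (fun t => (Real.exp (-c * t) : ℂ) * f t) 2 volume := by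
  have hweight : AEStronglyMeasurable f (weightMeasure c) :=
    hf.mono_ac (withDensity_absolutelyContinuous _ _)
  have hexp : AEStronglyMeasurable (fun t => (Real.exp (-c * t) : ℂ) * f t) volume :=
    AEStronglyMeasurable.mul (by fun_prop) hf
  rw [MemLp, MemLp, and_iff_right hweight, and_iff_right hexp, eLpNorm_exp_mul c hf]

theorem exp_mul_exp_neg_mul (t : ℝ) (z : ℂ) :
    (Real.exp (c * t) : ℂ) * ((Real.exp (-c * t) : ℂ) * z) = z := by
  rw [← mul_assoc, ← Complex.ofReal_mul, ← Real.exp_add]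
  simp

variable {c} in
theorem aestronglyMeasurable_volume (f : HilbertSpace c) : AEStronglyMeasurable f volume :=
  (Lp.aestronglyMeasurable f).mono_ac (volume_absolutelyContinuous_weightMeasure c)

variable {c} in
theorem memLp_exp_mul (f : HilbertSpace c) :
    MemLp (fun t => (Real.exp (-c * t) : ℂ) * f t) 2 volume :=
  (memLp_weightMeasure_iff c (aestronglyMeasurable_volume f)).1 (Lp.memLp f)

/-- Multiplication by `e^{-ct}`, as a linear map from `ℍ_c` to `L²(ℝ)`. -/
noncomputable def unweightLinearMap : HilbertSpace c →ₗ[ℂ] Lp ℂ 2 (volume : Measure ℝ) :=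
  mulLp _ (volume_absolutelyContinuous_weightMeasure c) memLp_exp_mul

theorem coeFn_unweightLinearMap (f : HilbertSpace c) :
    unweightLinearMap c f =ᵐ[volume] fun t => (Real.exp (-c * t) : ℂ) * f t :=
  coeFn_mulLp (volume_absolutelyContinuous_weightMeasure c) memLp_exp_mul f

theorem norm_unweightLinearMap (f : HilbertSpace c) : ‖unweightLinearMap c f‖ = ‖f‖ := by
  rw [Lp.norm_def, eLpNorm_congr_ae (coeFn_unweightLinearMap c f),
    eLpNorm_exp_mul c (aestronglyMeasurable_volume f), Lp.norm_def]

theorem surjective_unweightLinearMap : Function.Surjective (unweightLinearMap c) := by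
  intro g
  have hcancel (t : ℝ) : (Real.exp (-c * t) : ℂ) * (Real.exp (c * t) * g t) = g t := by
    simpa only [neg_neg] using exp_mul_exp_neg_mul (-c) t (g t)
  have hmeas : AEStronglyMeasurable (fun t => (Real.exp (c * t) : ℂ) * g t) volume :=
    AEStronglyMeasurable.mul (by fun_prop) (Lp.aestronglyMeasurable g)
  have hg : MemLp (fun t => (Real.exp (c * t) : ℂ) * g t) 2 (weightMeasure c) :=
    (memLp_weightMeasure_iff c hmeas).2 (by simpa only [hcancel] using Lp.memLp g)
  refine ⟨hg.toLp _, Lp.ext ?_⟩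
  filter_upwards [coeFn_unweightLinearMap c (hg.toLp _),
    (ae_weightMeasure_iff c).1 hg.coeFn_toLp] with t hmul hcoe
  rw [hmul, hcoe, hcancel]

/-- Multiplication by `e^{-ct}`, as a unitary operator from `ℍ_c` onto `L²(ℝ)`. -/
noncomputable def unweight : HilbertSpace c ≃ₗᵢ[ℂ] Lp ℂ 2 (volume : Measure ℝ) :=
  .ofSurjective ⟨unweightLinearMap c, norm_unweightLinearMap c⟩ (surjective_unweightLinearMap c)

theorem coeFn_unweight (f : HilbertSpace c) :
    unweight c f =ᵐ[volume] fun t => (Real.exp (-c * t) : ℂ) * f t :=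
  coeFn_unweightLinearMap c f

variable {c} {x y : HilbertSpace c}

theorem mem_shiftGraph_iff_isAEDeriv :
    (x, y) ∈ shiftGraph c ↔ IsAEDeriv (unweight c x) (unweight c (y - (c : ℂ) • x)) := by
  have hx := coeFn_unweight c x
  have hy : ∀ᵐ t, unweight c (y - (c : ℂ) • x) t = (Real.exp (-c * t) : ℂ) * (y t - c * x t) := by
    filter_upwards [coeFn_unweight c (y - (c : ℂ) • x),
      (ae_weightMeasure_iff c).1 (Lp.coeFn_sub y ((c : ℂ) • x)),
      (ae_weightMeasure_iff c).1 (Lp.coeFn_smul (c : ℂ) x)] with t hmul hsub hsmul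
    rw [hmul, hsub, Pi.sub_apply, hsmul, Pi.smul_apply, smul_eq_mul]
  constructor
  · rintro ⟨F, hF, hxF, hF'⟩
    rw [ae_weightMeasure_iff] at hxF hF'
    refine ⟨fun t => Real.exp (-c * t) • F t,
      fun a b => absolutelyContinuousOnInterval_exp_smul (hF a b) (-c), ?_, ?_⟩
    · filter_upwards [hx, hxF] with t ht hxt
      rw [ht, Complex.real_smul, ← hxt]
    · filter_upwards [hy, hxF, hF'] with t ht hxt hFt
      have h := hasDerivAt_exp_smul (-c) hFt
      rw [← hxt, Complex.real_smul] at h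
      rw [ht]
      convert! h using 1
      push_cast
      ring
  · rintro ⟨G, hG, hxG, hG'⟩
    refine ⟨fun t => Real.exp (c * t) • G t,
      fun a b => absolutelyContinuousOnInterval_exp_smul (hG a b) c, ?_, ?_⟩
    · rw [ae_weightMeasure_iff]
      filter_upwards [hx, hxG] with t ht hxt
      rw [← hxt, ht, Complex.real_smul, exp_mul_exp_neg_mul]
    · rw [ae_weightMeasure_iff]
      filter_upwards [hx, hy, hxG, hG'] with t ht hyt hxt hGt
      have h := hasDerivAt_exp_smul c hGt
      rwa [← hxt, ht, hyt, Complex.real_smul, mul_left_comm (c : ℂ), ← mul_add,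
        exp_mul_exp_neg_mul, sub_add_cancel] at h

variable (c)

/-- The unitary operator `f ↦ 𝓕(e^{-ct} f)`, which diagonalizes the infinitesimal shift. -/
noncomputable def weightedFourier : HilbertSpace c ≃ₗᵢ[ℂ] Lp ℂ 2 (volume : Measure ℝ) :=
  (unweight c).trans (Lp.fourierTransformₗᵢ ℝ ℂ)

/-- The function `ξ ↦ c + 2πiξ`, by which `∂_c` multiplies on the Fourier side. -/
noncomputable def shiftSymbol (ξ : ℝ) : ℂ := c + 2 * π * Complex.I * ξ

theorem continuous_shiftSymbol : Continuous (shiftSymbol c) := by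
  unfold shiftSymbol
  fun_prop

variable {c} in
theorem mem_graph_infinitesimalShift_iff : (x, y) ∈ (infinitesimalShift c).graph ↔
    weightedFourier c y =ᵐ[volume] fun ξ => shiftSymbol c ξ * weightedFourier c x ξ := by
  have hfourier : (x, y) ∈ (infinitesimalShift c).graph ↔
      weightedFourier c (y - (c : ℂ) • x) =ᵐ[volume]
        fun ξ : ℝ => 2 * π * Complex.I * ξ * weightedFourier c x ξ := by
    rw [infinitesimalShift_graph, mem_shiftGraph_iff_isAEDeriv, isAEDeriv_iff_fourier]
    rfl
  rw [hfourier, map_sub, map_smul]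
  refine eventually_congr ?_
  filter_upwards [Lp.coeFn_sub (weightedFourier c y) ((c : ℂ) • weightedFourier c x),
    Lp.coeFn_smul (c : ℂ) (weightedFourier c x)] with ξ hsub hsmul
  rw [hsub, Pi.sub_apply, hsmul, Pi.smul_apply, smul_eq_mul, sub_eq_iff_eq_add', shiftSymbol,
    add_mul]

theorem exists_isIntegral_momentum : ∃ E : ResolutionOfIdentity (HilbertSpace c),
    E.IsIntegral (fun z => z) (momentum c) ∧ E.support = range Complex.ofReal := by
  let E := (multiplicationResolution volume _ (continuous_shiftSymbol c).measurable).comap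
    (weightedFourier c)
  have hE : E.IsIntegral (fun z => z) (infinitesimalShift c) :=
    isIntegral_comap_multiplicationResolution _ _ fun _ _ => mem_graph_infinitesimalShift_iff
  let h : ℂ → ℂ := fun z => Complex.I⁻¹ * (z - c)
  have hh : Continuous h := by fun_prop
  have hcomp (ξ : ℝ) : h (shiftSymbol c ξ) = ((2 * π * ξ : ℝ) : ℂ) := by
    simp only [h, shiftSymbol]
    push_cast
    field_simp
    ring
  refine ⟨E.map h hh.measurable, ?_, ?_⟩
  · exact (E.isIntegral_map_iff measurable_id hh.measurable).2
      ((hE.sub_constOp measurable_id c).smul (by fun_prop) (inv_ne_zero Complex.I_ne_zero))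
  · have hrange : range (h ∘ shiftSymbol c) = range Complex.ofReal := by
      have hscale : Function.Surjective fun ξ : ℝ => 2 * π * ξ :=
        mul_left_surjective₀ Real.two_pi_pos.ne'
      rw [← hscale.range_comp Complex.ofReal]
      exact congrArg range (funext hcomp)
    rw [E.support_map hh, ResolutionOfIdentity.support_comap,
      support_multiplicationResolution (continuous_shiftSymbol c), closure_image_closure hh,
      ← range_comp, hrange,
      Complex.isUniformEmbedding_ofReal.isClosedEmbedding.isClosed_range.closure_eq]

end Momentum

/-! ### Truncations -/

section Truncation

theorem measurable_riemannZeta : Measurable riemannZeta :=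
  measurable_of_continuousOn_compl_singleton 1 fun _ hs =>
    (differentiableAt_riemannZeta hs).continuousAt.continuousWithinAt

theorem exists_isIntegral_truncatedShift (c : ℝ) {φ : ℝ → ℝ} (hφ : Continuous φ) :
    ∃ E : ResolutionOfIdentity (HilbertSpace c), E.IsIntegral (fun z => z) (truncatedShift c φ) ∧
      E.support = closure ((fun τ : ℝ => (c + Complex.I * τ : ℂ)) '' range φ) := by
  obtain ⟨E₀, hE₀, hsupp₀⟩ := exists_isIntegral_momentum c
  have hφre : Continuous fun z : ℂ => (φ z.re : ℂ) := by fun_prop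
  have hh : Continuous fun z : ℂ => (c + Complex.I * φ z.re : ℂ) := by fun_prop
  obtain ⟨E, hE, hφE⟩ := exists_isIntegral_functionalCalculus hE₀ hφre.measurable
  refine ⟨E.map _ hh.measurable, (E.isIntegral_map_iff measurable_id hh.measurable).2
    ((hφE.smul hφre.measurable Complex.I_ne_zero).constOp_add (by fun_prop) c), ?_⟩
  rw [E.support_map hh, hE.support_eq, ← hE₀.support_eq, hsupp₀, ← range_comp, ← range_comp]
  rfl

variable {c T : ℝ} {φ : ℝ → ℝ}

theorem operatorSpectrum_truncatedShift (hφ : IsAdmissibleCutoff T φ) :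
    operatorSpectrum (truncatedShift c φ) =
      (fun τ : ℝ => (c + Complex.I * τ : ℂ)) '' Icc (-T) T := by
  obtain ⟨E, hE, hsupp⟩ := exists_isIntegral_truncatedShift c hφ.1
  have hcont : Continuous fun τ : ℝ => (c + Complex.I * τ : ℂ) := by fun_prop
  rw [← hE.support_eq, hsupp, ← closure_image_closure hcont, hφ.2,
    (isCompact_Icc.image hcont).isClosed.closure_eq]

theorem isInvertible_truncatedSpectralOperator_iff (hc : c ≠ 1) (hφ : IsAdmissibleCutoff T φ) :
    IsInvertible (truncatedSpectralOperator c φ) ↔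
      ∀ τ ∈ Icc (-T) T, riemannZeta (c + Complex.I * τ) ≠ 0 := by
  obtain ⟨E, hE, -⟩ := exists_isIntegral_truncatedShift c hφ.1
  have hcomp : IsCompact (operatorSpectrum (truncatedShift c φ)) := by
    rw [operatorSpectrum_truncatedShift hφ]
    exact isCompact_Icc.image (by fun_prop)
  have hcont : ContinuousOn riemannZeta (operatorSpectrum (truncatedShift c φ)) := by
    rw [operatorSpectrum_truncatedShift hφ]
    rintro _ ⟨τ, -, rfl⟩
    refine (differentiableAt_riemannZeta fun h => hc ?_).continuousAt.continuousWithinAt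
    simpa using congrArg Complex.re h
  rw [truncatedSpectralOperator,
    isInvertible_functionalCalculus_iff hE measurable_riemannZeta hcomp hcont,
    operatorSpectrum_truncatedShift hφ, forall_mem_image]

theorem isQuasiInvertible_iff {φ : ℝ → ℝ → ℝ} (hc : c ≠ 1)
    (hφ : ∀ T, 0 < T → IsAdmissibleCutoff T (φ T)) :
    IsQuasiInvertible c φ ↔ ∀ s : ℂ, s.re = c → riemannZeta s ≠ 0 := by
  have hinv : IsQuasiInvertible c φ ↔
      ∀ T : ℝ, 0 < T → ∀ τ ∈ Icc (-T) T, riemannZeta (c + Complex.I * τ) ≠ 0 :=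
    forall₂_congr fun T hT => isInvertible_truncatedSpectralOperator_iff hc (hφ T hT)
  refine hinv.trans ⟨fun h s hs => ?_, fun h T _ τ _ => h _ (by simp)⟩
  subst hs
  simpa only [mul_comm Complex.I, Complex.re_add_im] using
    h (|s.im| + 1) (by positivity) s.im (abs_le.1 (by linarith))

end Truncation

/-! ### The Riemann hypothesis -/

section RiemannHypothesis

theorem riemannZeta_one_sub_eq_zero {s : ℂ} (hs : riemannZeta s = 0)
    (htriv : ¬∃ n : ℕ, s = -2 * (n + 1)) (hs1 : s ≠ 1) : riemannZeta (1 - s) = 0 := by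
  have hs0 : s ≠ 0 := by
    rintro rfl
    norm_num [riemannZeta_zero] at hs
  have hΓ : s.Gammaℝ ≠ 0 := by
    rw [Ne, Complex.Gammaℝ_eq_zero_iff]
    rintro ⟨_ | n, hn⟩
    · exact hs0 (by simpa using hn)
    · exact htriv ⟨n, by rw [hn]; push_cast; ring⟩
  have hΛ : completedRiemannZeta s = 0 := by
    simpa [riemannZeta_def_of_ne_zero hs0, hΓ] using hs
  rw [riemannZeta_def_of_ne_zero (sub_ne_zero.2 hs1.symm), completedRiemannZeta_one_sub, hΛ,
    zero_div]

theorem riemannHypothesis_of_strip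
    (h : ∀ s : ℂ, 1 / 2 < s.re → s.re < 1 → riemannZeta s ≠ 0) : RiemannHypothesis := by
  have hright (s : ℂ) (hs : riemannZeta s = 0) : s.re ≤ 1 / 2 := by
    by_contra! hre
    exact (lt_or_ge s.re 1).elim (h s hre) (riemannZeta_ne_zero_of_one_le_re ·) hs
  intro s hs htriv hs1
  have hreflect := hright (1 - s) (riemannZeta_one_sub_eq_zero hs htriv hs1)
  rw [Complex.sub_re, Complex.one_re] at hreflect
  linarith [hright s hs]

theorem riemannZeta_ne_zero_of_riemannHypothesis (hRH : RiemannHypothesis) {s : ℂ}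
    (h0 : 0 < s.re) (h1 : s ≠ 1) (h2 : s.re ≠ 1 / 2) : riemannZeta s ≠ 0 := by
  refine fun hs => h2 (hRH s hs ?_ h1)
  rintro ⟨n, rfl⟩
  have hre : (-2 * (n + 1) : ℂ).re = -2 * (n + 1) := by simp
  rw [hre] at h0
  linarith [Nat.cast_nonneg (α := ℝ) n]

end RiemannHypothesis

end SpectralOperator

theorem theorem6p1 (φ : ℝ → ℝ → ℝ → ℝ)
    (hφ : ∀ c ∈ Set.Ioo (0 : ℝ) 1, ∀ T : ℝ, 0 < T → SpectralOperator.IsAdmissibleCutoff T (φ c T)) :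
    ((∀ c ∈ Set.Ioo (0 : ℝ) 1 \ {1 / 2}, SpectralOperator.IsQuasiInvertible c (φ c)) ↔
      RiemannHypothesis) ∧
    ((∀ c ∈ Set.Ioo (1 / 2 : ℝ) 1, SpectralOperator.IsQuasiInvertible c (φ c)) ↔
      RiemannHypothesis) := by
  have hzeta (c : ℝ) (hc : c ∈ Set.Ioo (0 : ℝ) 1) : SpectralOperator.IsQuasiInvertible c (φ c) ↔
      ∀ s : ℂ, s.re = c → riemannZeta s ≠ 0 :=
    SpectralOperator.isQuasiInvertible_iff hc.2.ne (hφ c hc)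
  have hsub : Set.Ioo (1 / 2 : ℝ) 1 ⊆ Set.Ioo (0 : ℝ) 1 \ {1 / 2} := fun c hc =>
    ⟨⟨by linarith [hc.1], hc.2⟩, hc.1.ne'⟩
  have hstrip (h : ∀ c ∈ Set.Ioo (1 / 2 : ℝ) 1, SpectralOperator.IsQuasiInvertible c (φ c)) :
      RiemannHypothesis :=
    SpectralOperator.riemannHypothesis_of_strip fun s hs hs1 =>
      (hzeta s.re (hsub ⟨hs, hs1⟩).1).1 (h s.re ⟨hs, hs1⟩) s rfl
  have hline (hRH : RiemannHypothesis) (c : ℝ) (hc : c ∈ Set.Ioo (0 : ℝ) 1 \ {1 / 2}) :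
      SpectralOperator.IsQuasiInvertible c (φ c) := by
    rw [hzeta c hc.1]
    rintro s rfl
    refine SpectralOperator.riemannZeta_ne_zero_of_riemannHypothesis hRH hc.1.1 ?_ hc.2
    rintro rfl
    exact hc.1.2.ne Complex.one_re
  exact ⟨⟨fun h => hstrip fun c hc => h c (hsub hc), hline⟩,
    ⟨hstrip, fun hRH c hc => hline hRH c (hsub hc)⟩⟩
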